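/- Akopyan's approximation theorem (2-dimensional case). Conventions. A \emph{triangulation} of a metric space $P$ is a finite triangulation such that every (closed) simplex of it, with the metric of $P$, is isometric to a nondegenerate simplex in a Euclidean space; points of a simplex have barycentric coordinates through this isometry. A \emph{$2$-dimensional polyhedral space} is a metric space $P$ which is a length space (the distance between two points is the infimum of the lengths of the paths joining them) and which admits a triangulation whose simplices have maximal dimension $2$. A map $f\colon P\to\mathbb R^n$ is \emph{piecewise distance preserving} if there is a triangulation of $P$ such that $|f(x)-f(y)|=|x-y|_P$ whenever $x,y$ lie in one simplex of it. A map $h\colon P\to\mathbb R^n$ is \emph{piecewise linear} if there is a triangulation of $P$ such that, for every simplex with vertices $v_0,\dots,v_k$ and every point $x$ of it with barycentric coordinates $(\lambda_0,\dots,\lambda_k)$, $h(x)=\lambda_0 h(v_0)+\dots+\lambda_k h(v_k)$. A map $h\colon P\to\mathbb R^n$ is \emph{distance non-expanding} if $|h(x)-h(y)|\le|x-y|_P$ for all $x,y\in P$. Theorem. Let $P$ be a $2$-dimensional polyhedral space. Then for every distance non-expanding piecewise linear map $h\colon P\to\mathbb R^2$ and every $\varepsilon>0$ there is a piecewise distance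 preserving map $f\colon P\to\mathbb R^2$ such that $|f(x)-h(x)|<\varepsilon$ for all $x\in P$. In particular (Zalgaller's theorem), every $2$-dimensional polyhedral space admits a piecewise distance preserving map to $\mathbb R^2$. -/

import Mathlib

namespace Polyhedral

/-- A metric space is a length space if the distance between any two points is the infimum of the
lengths of the (continuous) paths joining them. In particular any two points are joined by a path
of finite length. -/
def IsLengthSpace (P : Type*) [MetricSpace P] : Prop :=
  ∀ x y : P, edist x y = ⨅ γ : Path x y, eVariationOn γ Set.univ

/-- The geometric realization of an abstract simplicial complex `K`: systems of barycentric
coordinates, that is, nonnegative weights of total mass one on the vertices, whose support is a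
simplex of `K`. -/
def Realization {V : Type*} (K : PreAbstractSimplicialComplex V) : Type _ :=
  {w : V →₀ ℝ // (∀ v, 0 ≤ w v) ∧ (w.sum fun _ a => a) = 1 ∧ w.support ∈ K.faces}

/-- A (finite, Euclidean) triangulation of a metric space `P`. Its vertices are points of `P`,
and it is an abstract simplicial complex on them with finitely many simplices, together with an
identification of `P` with the geometric realization, sending each vertex to itself, such that
every simplex, with the metric of `P`, is isometric to a nondegenerate simplex in a Euclidean space,
the isometry being affine in the barycentric coordinates. (Since each of the finitely many simplices
is isometric to a Euclidean one, the identification is automatically a homeomorphism.) -/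
structure Triangulation (P : Type*) [MetricSpace P] extends PreAbstractSimplicialComplex P where
  /-- there are finitely many simplices -/
  finite_faces : faces.Finite
  /-- barycentric coordinates -/
  coord : P ≃ Realization toPreAbstractSimplicialComplex
  /-- each vertex has weight one at itself -/
  coord_vertex : ∀ v : P, {v} ∈ faces → (coord v).1 = Finsupp.single v 1
  /-- each simplex is isometric to the convex hull of affinely independent points `p v` -/
  isometric : ∀ s ∈ faces, ∃ (n : ℕ) (p : P → EuclideanSpace ℝ (Fin n)),
    AffineIndependent ℝ (fun v : s => p v) ∧
    ∀ x y : P, (coord x).1.support ⊆ s → (coord y).1.support ⊆ s →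
      dist x y = dist (∑ v ∈ s, (coord x).1 v • p v) (∑ v ∈ s, (coord y).1 v • p v)

namespace Triangulation

variable {P : Type*} [MetricSpace P]

/-- The closed simplex of `P` with vertex set `s`. -/
def simplex (T : Triangulation P) (s : Finset P) : Set P :=
  {x | (T.coord x).1.support ⊆ s}

/-- The largest dimension of a simplex of the triangulation is `m`. -/
def HasDimension (T : Triangulation P) (m : ℕ) : Prop :=
  (∀ s ∈ T.faces, s.card ≤ m + 1) ∧ ∃ s ∈ T.faces, s.card = m + 1

end Triangulation

/-- `P` is an `m`-dimensional polyhedral space: a length space which admits a finite triangulation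
by Euclidean simplices of maximal dimension `m`. -/
def IsPolyhedralSpace (P : Type*) [MetricSpace P] (m : ℕ) : Prop :=
  IsLengthSpace P ∧ ∃ T : Triangulation P, T.HasDimension m

/-- `f` is distance preserving on each simplex of some triangulation of `P`. -/
def IsPiecewiseDistancePreserving {P : Type*} [MetricSpace P] {n : ℕ}
    (f : P → EuclideanSpace ℝ (Fin n)) : Prop :=
  ∃ T : Triangulation P, ∀ s ∈ T.faces, ∀ x ∈ T.simplex s, ∀ y ∈ T.simplex s,
    dist (f x) (f y) = dist x y

/-- `h` is linear in the barycentric coordinates on each simplex of some triangulation of `P`. -/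
def IsPiecewiseLinear {P : Type*} [MetricSpace P] {n : ℕ}
    (h : P → EuclideanSpace ℝ (Fin n)) : Prop :=
  ∃ T : Triangulation P, ∀ s ∈ T.faces, ∀ x ∈ T.simplex s,
    h x = ∑ v ∈ s, (T.coord x).1 v • h v

end Polyhedral

/-!
The approximation of a non-expanding map `h` to the plane is built on the edges and then on the
triangles of a given triangulation, by means of Brehm's extension theorem
(`exists_isPiecewiseIsometric_extension`): a non-expanding map of a *finite* set of points of a
Euclidean space extends to a piecewise isometric map of the whole space. It is proved by
prescribing one value at a time, replacing the map on a star-shaped neighbourhood of the new point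
by the cone over its boundary values (`IsPiecewiseIsometric.exists_update`). "Piecewise isometric"
means here non-expanding and, on bounded sets, selected pointwise from finitely many isometries.

Prescribing finitely many values is enough to prescribe the map on an edge: a piecewise isometric
curve is determined among all non-expanding curves by its values at its break points
(`exists_finite_determining`). So the maps obtained in the triangles at an edge agree on it, once
they agree at finitely many of its points.

It remains to arrange that the prescribed values are non-expanding. The map `h` is first
multiplied by a constant less than `1`, and soft thresholds make it constant near the vertices
without increasing any distance (`exists_locallyConst`); the result `g` is contracting, so that
for points at a distance bounded from below small errors do no harm. Small distances between
points of different edges occur only near a common vertex `w` (`exists_separation`). There all the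
edges are mapped by the same rule, a zigzag of small amplitude on a ray from `g w`, as a function
of the distance to `w` (`vertexModel`), and this is non-expanding whatever the metric near `w` is.
Brehm's theorem extends these models to maps of the edges close to `g` (`exists_edge_map`), and
the edge maps, together with the values of `g` at a finite net in the interior, to the triangles
(`exists_face_map`).

Finally, a map that is piecewise isometric in an isometric chart of each simplex is distance
preserving on the simplices of some triangulation (`isPiecewiseDistancePreserving`). If no
coordinate of the difference of two of the isometries in the selection changes sign on a segment,
then the selected isometry cannot change along it (`dist_eq_of_sameSign`). Sign changes of
finitely many functions, each affine on one simplex, are removed by subdividing the crossed edges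
at the zeros (`exists_refines_forall_sameSign`); each subdivision decreases the number of crossed
edges, since the new edges end at a zero.
-/

namespace Polyhedral

open Metric Set Module

/-! ### Piecewise isometric maps -/

/-- `f` is non-expanding and on every bounded set it coincides, at each point, with one of finitely
many isometric maps. Unlike a description by a cell decomposition, this notion requires no
description of the pieces; they are recovered by `dist_eq_of_sameSign`. -/
def IsPiecewiseIsometric {V W : Type*} [NormedAddCommGroup V] [NormedAddCommGroup W]
    (f : V → W) : Prop :=
  LipschitzWith 1 f ∧ ∀ r : ℝ, ∃ S : Set (V → W), S.Finite ∧ (∀ I ∈ S, Isometry I) ∧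
    ∀ x, ‖x‖ ≤ r → ∃ I ∈ S, f x = I x

lemma isPiecewiseIsometric_of_isometry {V W : Type*} [NormedAddCommGroup V]
    [NormedAddCommGroup W] {f : V → W} (hf : Isometry f) : IsPiecewiseIsometric f :=
  ⟨hf.lipschitz, fun _ => ⟨{f}, finite_singleton f, by simpa using hf, fun x _ => ⟨f, rfl, rfl⟩⟩⟩

/-- Along every ray from `a`, the points that are too close to `a` are followed by a point at the
correct distance, since `f` is bounded. -/
lemma exists_dist_eq_on_ray {V W : Type*} [NormedAddCommGroup V] [NormedSpace ℝ V]
    [NormedAddCommGroup W] {f : V → W} (hf : Continuous f) {B : ℝ} (hB : ∀ x, ‖f x‖ ≤ B)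
    (a : V) (b : W) {e : V} (he : e ≠ 0) {t₀ : ℝ} (ht : 0 ≤ t₀)
    (h0 : dist (a + t₀ • e) a ≤ dist (f (a + t₀ • e)) b) :
    ∃ t, t₀ ≤ t ∧ dist (f (a + t • e)) b = dist (a + t • e) a := by
  have hd : ∀ t : ℝ, 0 ≤ t → dist (a + t • e) a = t * ‖e‖ := fun t ht => by
    rw [dist_eq_norm, add_sub_cancel_left, norm_smul, Real.norm_of_nonneg ht]
  have hpos : 0 < ‖e‖ := norm_pos_iff.2 he
  set T := max t₀ ((B + ‖b‖) / ‖e‖)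
  have hT : dist (f (a + T • e)) b - dist (a + T • e) a ≤ 0 := by
    rw [hd T (ht.trans (le_max_left _ _))]
    have : (B + ‖b‖) ≤ T * ‖e‖ := (div_le_iff₀ hpos).1 (le_max_right _ _)
    have := dist_le_norm_add_norm (f (a + T • e)) b
    have := hB (a + T • e)
    linarith
  have hc : ContinuousOn (fun t : ℝ => dist (f (a + t • e)) b - dist (a + t • e) a)
      (Icc t₀ T) := by fun_prop
  obtain ⟨t, ht', h⟩ := intermediate_value_Icc' (le_max_left _ _) hc
    (show (0 : ℝ) ∈ Icc _ _ from ⟨hT, by linarith⟩)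
  exact ⟨t, ht'.1, by simpa [sub_eq_zero] using h⟩

section InnerProduct

variable {V W : Type*} [NormedAddCommGroup V] [InnerProductSpace ℝ V]
  [NormedAddCommGroup W] [InnerProductSpace ℝ W]

lemma Isometry.map_lineMap {f : V → W} (hf : Isometry f) (x y : V) (c : ℝ) :
    f (AffineMap.lineMap x y c) = AffineMap.lineMap (f x) (f y) c :=
  hf.affineIsometryOfStrictConvexSpace.toAffineMap.apply_lineMap x y c

/-- Stewart's theorem. -/
lemma dist_lineMap_sq (z a p : V) (k : ℝ) :
    dist z (AffineMap.lineMap a p k) ^ 2 =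
      (1 - k) * dist z a ^ 2 + k * dist z p ^ 2 - k * (1 - k) * dist p a ^ 2 := by
  have h1 : z - AffineMap.lineMap a p k = (z - a) - k • (p - a) := by
    rw [AffineMap.lineMap_apply_module']; abel
  have h2 : z - p = (z - a) - (p - a) := by abel
  rw [dist_eq_norm, dist_eq_norm, dist_eq_norm, dist_eq_norm, h1, h2, norm_sub_sq_real (z - a),
    norm_sub_sq_real (z - a), norm_smul, real_inner_smul_right, mul_pow, Real.norm_eq_abs, sq_abs]
  ring

/-- The reflection of the target in the perpendicular bisector of `u` and `b`. -/
lemma exists_isometry_reflection (u b : W) : ∃ ρ : W → W, Isometry ρ ∧ ρ u = b ∧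
    ∀ q, dist q u = dist q b → ρ q = q := by
  set m : W := (1 / 2 : ℝ) • (u + b) with hm
  set K : Submodule ℝ W := (Submodule.span ℝ {u - b})ᗮ
  have e1 : u - m = (1 / 2 : ℝ) • (u - b) := by rw [hm]; module
  have e2 : b - m = -((1 / 2 : ℝ) • (u - b)) := by rw [hm]; module
  refine ⟨fun y => m + K.reflection (y - m), ?_, ?_, ?_⟩
  · refine Isometry.of_dist_eq fun x y => ?_
    rw [dist_add_left, LinearIsometryEquiv.dist_map, dist_sub_right]
  · have : K.reflection (u - m) = b - m := by
      have hn : ‖u - m‖ = ‖b - m‖ := by rw [e1, e2, norm_neg]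
      have h := Submodule.reflection_sub hn
      rw [show (u - m) - (b - m) = u - b by abel] at h
      exact h
    simp only [this]; abel
  · intro q hq
    have : q - m ∈ K := by
      rw [Submodule.mem_orthogonal_singleton_iff_inner_right]
      have h1 : q - u = (q - m) - (1 / 2 : ℝ) • (u - b) := by rw [hm]; module
      have h2 : q - b = (q - m) + (1 / 2 : ℝ) • (u - b) := by rw [hm]; module
      rw [dist_eq_norm, dist_eq_norm, h1, h2] at hq
      have h3 := congrArg (· ^ 2) hq
      simp only [norm_sub_sq_real, norm_add_sq_real, real_inner_smul_right] at h3
      rw [real_inner_comm]; linarith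
    simp only [Submodule.reflection_eq_self_iff _ |>.2 this]; abel

/-- The inductive step of Brehm's theorem: the value of a bounded piecewise isometric map can be
changed at one point `a` to any `b`, without changing it at the points `x` for which `dist (f x)
b ≤ dist x a`. The remaining points form a star-shaped neighbourhood of `a`, on which the new
map is the cone over the map on its boundary; Stewart's theorem shows that it is non-expanding,
and on the cone over a piece of the boundary it is the old isometry followed by a reflection. -/
lemma IsPiecewiseIsometric.exists_update [Nontrivial V] {f : V → W} (hf : IsPiecewiseIsometric f)
    {B : ℝ} (hB : ∀ x, ‖f x‖ ≤ B) (a : V) (b : W) :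
    ∃ g : V → W, IsPiecewiseIsometric g ∧ (∃ B', ∀ x, ‖g x‖ ≤ B') ∧ g a = b ∧
      ∀ x, dist (f x) b ≤ dist x a → g x = f x := by
  have hL : ∀ x y, dist (f x) (f y) ≤ dist x y := fun x y => by simpa using hf.1.dist_le_mul x y
  have key : ∀ x : V, ∃ y : W, (dist (f x) b ≤ dist x a ∧ y = f x) ∨
      (dist x a < dist (f x) b ∧ ∃ (p : V) (k : ℝ), 0 ≤ k ∧ k ≤ 1 ∧ x = AffineMap.lineMap a p k ∧
        y = AffineMap.lineMap b (f p) k ∧ dist (f p) b = dist p a) := by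
    intro x
    rcases le_or_gt (dist (f x) b) (dist x a) with h | h
    · exact ⟨f x, Or.inl ⟨h, rfl⟩⟩
    · by_cases hx : x = a
      · obtain ⟨e, he⟩ := exists_ne (0 : V)
        obtain ⟨t, -, h2⟩ := exists_dist_eq_on_ray hf.1.continuous hB a b he le_rfl
          (by simp)
        exact ⟨b, Or.inr ⟨h, _, 0, le_rfl, zero_le_one, by simp [hx], by simp, h2⟩⟩
      · have hx' : x - a ≠ 0 := sub_ne_zero.2 hx
        obtain ⟨t, h1, h2⟩ := exists_dist_eq_on_ray hf.1.continuous hB a b hx' zero_le_one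
          (by simpa using h.le)
        refine ⟨_, Or.inr ⟨h, a + t • (x - a), t⁻¹, by positivity, inv_le_one_of_one_le₀ h1, ?_,
          rfl, h2⟩⟩
        rw [AffineMap.lineMap_apply_module', add_sub_cancel_left, smul_smul,
          inv_mul_cancel₀ (by positivity), one_smul]
        abel
  choose g hg using key
  have hA : ∀ z x, dist (f z) b ≤ dist z a → dist (f z) (g x) ≤ dist z x := by
    intro z x hz
    rcases hg x with ⟨-, h⟩ | ⟨-, p, k, k0, k1, hx, hy, hp⟩
    · rw [h]; exact hL z x
    · refine abs_le_of_sq_le_sq' ?_ dist_nonneg |>.2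
      rw [hy, hx, dist_lineMap_sq, dist_lineMap_sq, hp]
      have e1 := pow_le_pow_left₀ dist_nonneg hz 2
      have e2 := pow_le_pow_left₀ dist_nonneg (hL z p) 2
      have := mul_le_mul_of_nonneg_left e1 (sub_nonneg.2 k1)
      have := mul_le_mul_of_nonneg_left e2 k0
      linarith
  have hb : ∀ x, dist x a < dist (f x) b → dist (g x) b = dist x a := by
    intro x hx
    rcases hg x with ⟨h, -⟩ | ⟨-, p, k, k0, k1, hx, hy, hp⟩
    · exact absurd hx h.not_gt
    · rw [hy, dist_lineMap_left, dist_comm b, hp, hx, dist_lineMap_left, dist_comm a]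
  have hgl : LipschitzWith 1 g := by
    refine LipschitzWith.of_dist_le_mul fun x y => ?_
    rw [NNReal.coe_one, one_mul]
    rcases hg x with ⟨h, hx⟩ | ⟨h, -⟩
    · rw [hx]; exact hA x y h
    rcases hg y with ⟨h', hy⟩ | ⟨h', p, k, k0, k1, hx, hy, hp⟩
    · rw [hy, dist_comm, dist_comm x]; exact hA y x h'
    · refine abs_le_of_sq_le_sq' ?_ dist_nonneg |>.2
      have e1 : dist (g x) (f p) ≤ dist x p := by
        rw [dist_comm, dist_comm x]; exact hA p x hp.le
      rw [hy, hx, dist_lineMap_sq, dist_lineMap_sq, hp, hb x h]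
      have e2 := pow_le_pow_left₀ dist_nonneg e1 2
      have := mul_le_mul_of_nonneg_left e2 k0
      linarith
  refine ⟨g, ⟨hgl, fun r => ?_⟩, ⟨B + ‖b‖ + ‖b‖, fun x => ?_⟩, ?_, ?_⟩
  · obtain ⟨S, hS, hI, hfS⟩ := hf.2 (max r (‖a‖ + (B + ‖b‖)))
    choose ρ hρ using fun I : V → W => exists_isometry_reflection (I a) b
    refine ⟨S ∪ (fun I => ρ I ∘ I) '' S, hS.union (hS.image _), ?_, fun x hx => ?_⟩
    · rintro I (hI' | ⟨I, hI', rfl⟩)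
      · exact hI I hI'
      · exact (hρ I).1.comp (hI I hI')
    rcases hg x with ⟨-, h⟩ | ⟨-, p, k, k0, k1, hx, hy, hp⟩
    · obtain ⟨I, h1, h2⟩ := hfS x (hx.trans (le_max_left _ _))
      exact ⟨I, Or.inl h1, h.trans h2⟩
    · have hpn : ‖p‖ ≤ ‖a‖ + (B + ‖b‖) := by
        have h1 := dist_le_norm_add_norm (f p) b
        have h2 : ‖p‖ ≤ ‖a‖ + dist p a := by
          rw [dist_eq_norm]; exact norm_le_insert' p a
        have := hB p
        linarith
      obtain ⟨I, h1, h2⟩ := hfS p (hpn.trans (le_max_right _ _))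
      refine ⟨ρ I ∘ I, Or.inr ⟨I, h1, rfl⟩, ?_⟩
      have h3 : (ρ I ∘ I) p = f p := by
        rw [Function.comp_apply, ← h2]
        refine (hρ I).2.2 _ ?_
        rw [h2, (hI I h1).dist_eq, ← h2, hp]
      have h4 : (ρ I ∘ I) a = b := (hρ I).2.1
      rw [hx, Isometry.map_lineMap ((hρ I).1.comp (hI I h1)), h3, h4, ← hx, hy]
  · rcases hg x with ⟨-, h⟩ | ⟨h, -⟩
    · rw [h]; have := hB x; have := norm_nonneg b; linarith
    · have h1 : ‖g x‖ ≤ ‖b‖ + dist (g x) b := by rw [dist_eq_norm]; exact norm_le_insert' _ _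
      have h2 := dist_le_norm_add_norm (f x) b
      have h3 := hB x
      rw [hb x h] at h1
      linarith
  · rcases hg a with ⟨h, h'⟩ | ⟨h, -⟩
    · rw [h']; simpa using h
    · simpa using hb a h
  · intro x hx
    rcases hg x with ⟨-, h⟩ | ⟨h, -⟩
    · exact h
    · exact absurd hx h.not_ge

end InnerProduct

/-! ### Zigzags and Brehm's extension theorem -/

/-- The distance from `t` to the lattice `2τℤ`: the zigzag function of slopes `±1` with values
in `[0, τ]`. -/
noncomputable def zigzag (τ t : ℝ) : ℝ := |t - 2 * τ * round (t / (2 * τ))|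

lemma zigzag_zero (τ : ℝ) : zigzag τ 0 = 0 := by simp [zigzag]

lemma zigzag_nonneg (τ t : ℝ) : 0 ≤ zigzag τ t := abs_nonneg _

lemma zigzag_eq_mul {τ : ℝ} (hτ : 0 < τ) (t : ℝ) (k : ℤ) :
    |t - 2 * τ * k| = 2 * τ * |t / (2 * τ) - k| := by
  rw [← abs_of_pos (show 0 < 2 * τ by positivity), ← abs_mul,
    abs_of_pos (show 0 < 2 * τ by positivity)]
  congr 1
  field_simp

lemma zigzag_le_abs_sub {τ : ℝ} (hτ : 0 < τ) (t : ℝ) (k : ℤ) : zigzag τ t ≤ |t - 2 * τ * k| := by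
  rw [zigzag, zigzag_eq_mul hτ, zigzag_eq_mul hτ]
  exact mul_le_mul_of_nonneg_left (round_le _ _) (by positivity)

lemma zigzag_le {τ : ℝ} (hτ : 0 < τ) (t : ℝ) : zigzag τ t ≤ τ := by
  rw [zigzag, zigzag_eq_mul hτ]
  have := mul_le_mul_of_nonneg_left (abs_sub_round (t / (2 * τ))) (show 0 ≤ 2 * τ by positivity)
  linarith

lemma abs_zigzag_sub_le {τ : ℝ} (hτ : 0 < τ) (s t : ℝ) : |zigzag τ s - zigzag τ t| ≤ |s - t| := by
  have key : ∀ s t, zigzag τ s - zigzag τ t ≤ |s - t| := fun s t => by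
    have h1 := zigzag_le_abs_sub hτ s (round (t / (2 * τ)))
    have h2 : |s - 2 * τ * round (t / (2 * τ))| ≤ |s - t| + zigzag τ t := abs_sub_le _ _ _
    linarith
  refine abs_le.2 ⟨?_, key s t⟩
  have := key t s
  rw [abs_sub_comm] at this
  linarith

lemma exists_finite_zigzag_eq {τ : ℝ} (hτ : 0 < τ) (r : ℝ) : ∃ M : Set ℝ, M.Finite ∧
    ∀ t, |t| ≤ r → ∃ m ∈ M, ∃ σ : ℝ, (σ = 1 ∨ σ = -1) ∧ zigzag τ t = σ * (t - m) := by
  set N : ℤ := ⌈r / (2 * τ) + 1 / 2⌉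
  refine ⟨(fun k : ℤ => 2 * τ * k) '' Icc (-N) N, (finite_Icc _ _).image _, fun t ht => ?_⟩
  refine ⟨_, ⟨round (t / (2 * τ)), ?_, rfl⟩, ?_⟩
  · rw [mem_Icc, ← abs_le]
    have h1 := abs_sub_round (t / (2 * τ))
    have h2 : |t / (2 * τ)| ≤ r / (2 * τ) := by
      rw [abs_div, abs_of_pos (show 0 < 2 * τ by positivity)]
      gcongr
    have h3 : |(round (t / (2 * τ)) : ℝ)| ≤ N := by
      have h4 := abs_sub_abs_le_abs_sub (round (t / (2 * τ)) : ℝ) (t / (2 * τ))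
      rw [abs_sub_comm] at h4
      have := Int.le_ceil (r / (2 * τ) + 1 / 2)
      linarith
    exact_mod_cast h3
  · rcases abs_choice (t - 2 * τ * round (t / (2 * τ))) with h | h
    · exact ⟨1, Or.inl rfl, by rw [zigzag, h, one_mul]⟩
    · exact ⟨-1, Or.inr rfl, by rw [zigzag, h, neg_one_mul]⟩

/-- Folding along the lines `x i ∈ ℤ`, `i = 1, …, n`, gives a bounded piecewise isometric map. -/
lemma exists_isPiecewiseIsometric_bounded (n : ℕ) :
    ∃ f : EuclideanSpace ℝ (Fin n) → EuclideanSpace ℝ (Fin n), IsPiecewiseIsometric f ∧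
      ∃ B, ∀ x, ‖f x‖ ≤ B := by
  refine ⟨fun x => WithLp.toLp 2 fun i => zigzag 1 (x i), ⟨?_, fun r => ?_⟩, √(∑ _i : Fin n, 1),
    fun x => ?_⟩
  · refine LipschitzWith.of_dist_le_mul fun x y => ?_
    rw [NNReal.coe_one, one_mul, EuclideanSpace.dist_eq, EuclideanSpace.dist_eq]
    refine Real.sqrt_le_sqrt (Finset.sum_le_sum fun i _ => ?_)
    exact pow_le_pow_left₀ dist_nonneg (abs_zigzag_sub_le one_pos _ _) 2
  · obtain ⟨M, hM, h⟩ := exists_finite_zigzag_eq one_pos r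
    have hfin : ((Set.pi univ fun _ : Fin n => M) ×ˢ
        (Set.pi univ fun _ : Fin n => ({1, -1} : Set ℝ))).Finite :=
      (Set.Finite.pi fun _ => hM).prod (Set.Finite.pi fun _ => Set.toFinite _)
    refine ⟨_, hfin.image fun q => fun x : EuclideanSpace ℝ (Fin n) =>
      (WithLp.toLp 2 fun i => q.2 i * (x i - q.1 i) : EuclideanSpace ℝ (Fin n)), ?_, fun x hx => ?_⟩
    · rintro _ ⟨⟨m, σ⟩, ⟨-, hσ⟩, rfl⟩
      refine Isometry.of_dist_eq fun x y => ?_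
      rw [EuclideanSpace.dist_eq, EuclideanSpace.dist_eq]
      congr 1
      refine Finset.sum_congr rfl fun i _ => ?_
      have h2 : σ i ^ 2 = 1 := sq_eq_one_iff.2 (by simpa using hσ i trivial)
      rw [Real.dist_eq, Real.dist_eq, sq_abs, sq_abs]
      simp only
      linear_combination (x i - y i) ^ 2 * h2
    · choose m hm σ hσ hz using fun i : Fin n => h (x i) (by
        rw [← Real.norm_eq_abs]; exact (PiLp.norm_apply_le x i).trans hx)
      exact ⟨_, ⟨(m, σ), ⟨fun i _ => hm i, fun i _ => hσ i⟩, rfl⟩, by simp only [hz]⟩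
  · rw [EuclideanSpace.norm_eq]
    refine Real.sqrt_le_sqrt (Finset.sum_le_sum fun i _ => ?_)
    rw [Real.norm_of_nonneg (zigzag_nonneg _ _)]
    exact pow_le_one₀ (zigzag_nonneg _ _) (zigzag_le one_pos _)

/-- Brehm's extension theorem: a non-expanding map of a finite set of points of a Euclidean space
extends to a piecewise isometric map of the space. -/
theorem exists_isPiecewiseIsometric_extension {n : ℕ} [NeZero n] {ι : Type*} (F : Finset ι)
    (a b : ι → EuclideanSpace ℝ (Fin n))
    (h : ∀ i ∈ F, ∀ j ∈ F, dist (b i) (b j) ≤ dist (a i) (a j)) :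
    ∃ f : EuclideanSpace ℝ (Fin n) → EuclideanSpace ℝ (Fin n), IsPiecewiseIsometric f ∧
      ∀ i ∈ F, f (a i) = b i := by
  suffices H : ∃ f : EuclideanSpace ℝ (Fin n) → EuclideanSpace ℝ (Fin n),
      IsPiecewiseIsometric f ∧ (∃ B, ∀ x, ‖f x‖ ≤ B) ∧ ∀ i ∈ F, f (a i) = b i by
    obtain ⟨f, h1, -, h2⟩ := H
    exact ⟨f, h1, h2⟩
  classical
  induction F using Finset.induction_on with
  | empty =>
    obtain ⟨f, h1, h2⟩ := exists_isPiecewiseIsometric_bounded n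
    exact ⟨f, h1, h2, by simp⟩
  | insert i F _ ih =>
    obtain ⟨f, h1, ⟨B, hB⟩, h2⟩ := ih fun j hj k hk =>
      h j (Finset.mem_insert_of_mem hj) k (Finset.mem_insert_of_mem hk)
    obtain ⟨g, h3, h4, h5, h6⟩ := h1.exists_update hB (a i) (b i)
    refine ⟨g, h3, h4, fun j hj => ?_⟩
    rcases Finset.mem_insert.1 hj with rfl | hj
    · exact h5
    · rw [h6, h2 j hj]
      rw [h2 j hj]
      exact h j (Finset.mem_insert_of_mem hj) i (Finset.mem_insert_self _ _)

/-! ### Recovering the pieces -/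

/-- The real numbers `a` and `b` do not have strictly opposite signs. -/
def SameSign (a b : ℝ) : Prop := (0 ≤ a ∧ 0 ≤ b) ∨ (a ≤ 0 ∧ b ≤ 0)

lemma SameSign.eq_zero_of_combo {a b c c' : ℝ} (h : SameSign a b) (h0 : 0 < c) (h1 : c < 1)
    (hz : (1 - c) * a + c * b = 0) : (1 - c') * a + c' * b = 0 := by
  have : a = 0 ∧ b = 0 := by
    rcases h with ⟨h2, h3⟩ | ⟨h2, h3⟩ <;> constructor <;> nlinarith
  simp [this.1, this.2]

/-- If a continuous function on a segment is selected from finitely many isometries, and no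
coordinate of a difference of two of them changes sign on the segment, then it is isometric on the
segment. Indeed two of the isometries agree either everywhere or nowhere in the open segment, so
that by connectedness the selected isometry cannot change. -/
lemma dist_eq_of_sameSign {V : Type*} [NormedAddCommGroup V] [InnerProductSpace ℝ V] {n : ℕ}
    {f : V → EuclideanSpace ℝ (Fin n)} {x y : V}
    (hf : ContinuousOn (fun c : ℝ => f (AffineMap.lineMap x y c)) (Icc 0 1))
    {S : Set (V → EuclideanSpace ℝ (Fin n))} (hS : S.Finite) (hI : ∀ I ∈ S, Isometry I)
    (hfS : ∀ c ∈ Icc (0 : ℝ) 1, ∃ I ∈ S, f (AffineMap.lineMap x y c) = I (AffineMap.lineMap x y c))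
    (hsign : ∀ I ∈ S, ∀ J ∈ S, ∀ j, SameSign ((I x - J x) j) ((I y - J y) j)) :
    dist (f x) (f y) = dist x y := by
  set u : ℝ → V := fun c => AffineMap.lineMap x y c with hu
  have hIc : ∀ I ∈ S, Continuous fun c => I (u c) := fun I h =>
    (hI I h).continuous.comp (by rw [hu]; exact AffineMap.lineMap_continuous)
  -- agreement of two of the isometries at one interior point of the segment propagates
  have hag : ∀ I ∈ S, ∀ J ∈ S, ∀ c ∈ Ioo (0 : ℝ) 1, ∀ c', I (u c) = J (u c) →
      I (u c') = J (u c') := by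
    intro I h J h' c hc c' e
    have hcoord : ∀ c j, (I (u c) - J (u c)) j =
        (1 - c) * (I x - J x) j + c * (I y - J y) j := by
      intro c j
      rw [hu]; simp only
      rw [Isometry.map_lineMap (hI I h), Isometry.map_lineMap (hI J h'),
        AffineMap.lineMap_apply_module, AffineMap.lineMap_apply_module]
      simp only [PiLp.sub_apply, PiLp.add_apply, PiLp.smul_apply, smul_eq_mul]
      ring
    rw [← sub_eq_zero]
    ext j
    rw [hcoord]
    refine (hsign I h J h' j).eq_zero_of_combo hc.1 hc.2 ?_
    rw [← hcoord, e, sub_self]; rfl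
  have hhalf : (1 / 2 : ℝ) ∈ Ioo (0 : ℝ) 1 := by constructor <;> norm_num
  obtain ⟨I, hIS, hI0⟩ := hfS (1 / 2) (Ioo_subset_Icc_self hhalf)
  have hall : EqOn (fun c => f (u c)) (fun c => I (u c)) (Ioo 0 1) := by
    set S' := {J ∈ S | ¬ J (u (1 / 2)) = I (u (1 / 2))}
    have hcl : ∀ J ∈ S, IsClosed {c ∈ Icc (0 : ℝ) 1 | f (u c) = J (u c)} := fun J h =>
      isClosed_Icc.isClosed_eq hf (hIc J h).continuousOn
    have hcl' : IsClosed (⋃ J ∈ S', {c ∈ Icc (0 : ℝ) 1 | f (u c) = J (u c)}) :=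
      (hS.subset (sep_subset _ _)).isClosed_biUnion fun J h => hcl J h.1
    have hcov : Ioo (0 : ℝ) 1 ⊆ {c ∈ Icc (0 : ℝ) 1 | f (u c) = I (u c)} ∪
        ⋃ J ∈ S', {c ∈ Icc (0 : ℝ) 1 | f (u c) = J (u c)} := by
      intro c hc
      obtain ⟨J, hJ, e⟩ := hfS c (Ioo_subset_Icc_self hc)
      by_cases h : J (u (1 / 2)) = I (u (1 / 2))
      · exact Or.inl ⟨Ioo_subset_Icc_self hc, e.trans (hag J hJ I hIS _ hhalf c h)⟩
      · exact Or.inr (mem_biUnion (show J ∈ S' from ⟨hJ, h⟩) ⟨Ioo_subset_Icc_self hc, e⟩)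
    intro c hc
    by_contra hne
    have hc2 : c ∈ ⋃ J ∈ S', {c ∈ Icc (0 : ℝ) 1 | f (u c) = J (u c)} :=
      (hcov hc).resolve_left fun h => hne h.2
    obtain ⟨c', hc', h1, h2⟩ := isPreconnected_closed_iff.1 isPreconnected_Ioo _ _ (hcl I hIS)
      hcl' hcov ⟨1 / 2, hhalf, Ioo_subset_Icc_self hhalf, hI0⟩ ⟨c, hc, hc2⟩
    obtain ⟨J, hJ, h3⟩ := mem_iUnion₂.1 h2
    exact hJ.2 (hag J hJ.1 I hIS c' hc' _ (h3.2.symm.trans h1.2))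
  have hall' : EqOn (fun c => f (u c)) (fun c => I (u c)) (Icc 0 1) :=
    hall.of_subset_closure hf (hIc I hIS).continuousOn Ioo_subset_Icc_self
      (by rw [closure_Ioo zero_ne_one])
  have e0 := hall' (show (0 : ℝ) ∈ Icc (0 : ℝ) 1 by simp)
  have e1 := hall' (show (1 : ℝ) ∈ Icc (0 : ℝ) 1 by simp)
  simp only [hu, AffineMap.lineMap_apply_zero, AffineMap.lineMap_apply_one] at e0 e1
  rw [e0, e1, (hI I hIS).dist_eq]

/-! ### Piecewise isometric curves and locally constant perturbations -/

/-- A non-expanding curve is straight between two parameters whose distance it preserves. -/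
lemma eq_lineMap_of_short {n : ℕ} {k : ℝ → EuclideanSpace ℝ (Fin n)} {p q t : ℝ} (hpt : p < t)
    (htq : t < q) (h1 : dist (k p) (k t) ≤ t - p) (h2 : dist (k t) (k q) ≤ q - t)
    (h3 : dist (k p) (k q) = q - p) :
    k t = AffineMap.lineMap (k p) (k q) ((t - p) / (q - p)) := by
  have h4 := dist_triangle (k p) (k t) (k q)
  have h5 : q - p ≠ 0 := by linarith
  apply eq_lineMap_of_dist_eq_mul_of_dist_eq_mul
  · rw [h3]; field_simp; linarith
  · rw [h3]; field_simp; linarith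

/-- An affine function with values of opposite signs at `p` and `q` vanishes between them. Here it
is given by its values `a` and `b` at `0` and `1`. -/
lemma exists_root_of_not_sameSign {a b p q : ℝ} (hpq : p < q)
    (h : ¬ SameSign ((1 - p) * a + p * b) ((1 - q) * a + q * b)) :
    p < a / (a - b) ∧ a / (a - b) < q := by
  rw [SameSign, not_or, not_and_or, not_and_or] at h
  simp only [not_le] at h
  have hab : a - b ≠ 0 := by
    intro h0
    obtain rfl : a = b := by linarith
    have e : ∀ c : ℝ, (1 - c) * a + c * a = a := fun c => by ring
    simp only [e, or_self] at h
    linarith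
  set ρ := a / (a - b)
  have hρ : a = ρ * (a - b) := by rw [div_mul_cancel₀ _ hab]
  have e : ∀ c : ℝ, (1 - c) * a + c * b = (b - a) * (c - ρ) := fun c => by linear_combination hρ
  rw [e, e] at h
  have hlt : (b - a) * (p - ρ) * ((b - a) * (q - ρ)) < 0 := by
    rcases h.1 with h1 | h1 <;> rcases h.2 with h2 | h2
    · linarith
    · exact mul_neg_of_neg_of_pos h1 h2
    · exact mul_neg_of_pos_of_neg h2 h1
    · linarith
  have hlt' : (p - ρ) * (q - ρ) < 0 := by
    by_contra hc
    have : 0 ≤ (b - a) ^ 2 * ((p - ρ) * (q - ρ)) := mul_nonneg (sq_nonneg _) (not_lt.1 hc)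
    nlinarith
  constructor <;> nlinarith

/-- A curve selected from finitely many unit speed lines is determined, among the non-expanding
curves, by its values at finitely many parameters, namely at its break points. -/
lemma exists_finite_determining {n : ℕ} {ψ : ℝ → EuclideanSpace ℝ (Fin n)} {α β : ℝ} (hαβ : α ≤ β)
    (hψ : ∀ s ∈ Icc α β, ∀ t ∈ Icc α β, dist (ψ s) (ψ t) ≤ |s - t|)
    {S : Set (ℝ → EuclideanSpace ℝ (Fin n))} (hS : S.Finite) (hI : ∀ I ∈ S, Isometry I)
    (hψS : ∀ t ∈ Icc α β, ∃ I ∈ S, ψ t = I t) :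
    ∃ A : Set ℝ, A.Finite ∧ A ⊆ Icc α β ∧ ∀ k : ℝ → EuclideanSpace ℝ (Fin n),
      (∀ s ∈ Icc α β, ∀ t ∈ Icc α β, dist (k s) (k t) ≤ |s - t|) → EqOn k ψ A →
      EqOn k ψ (Icc α β) := by
  set root : (ℝ → EuclideanSpace ℝ (Fin n)) × (ℝ → EuclideanSpace ℝ (Fin n)) × Fin n → ℝ :=
    fun q => (q.1 0 - q.2.1 0) q.2.2 / ((q.1 0 - q.2.1 0) q.2.2 - (q.1 1 - q.2.1 1) q.2.2)
  -- the parameters at which a coordinate of two of the lines coincides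
  set A : Set ℝ := {α, β} ∪ (root '' (S ×ˢ S ×ˢ univ) ∩ Icc α β)
  have hA : A.Finite := (Set.toFinite _).union
    (((hS.prod (hS.prod finite_univ)).image _).subset inter_subset_left)
  have hAsub : A ⊆ Icc α β := by
    rintro x ((rfl | rfl) | h)
    · exact ⟨le_rfl, hαβ⟩
    · exact ⟨hαβ, le_rfl⟩
    · exact h.2
  have hψc : ContinuousOn ψ (Icc α β) := by
    have : LipschitzOnWith 1 ψ (Icc α β) := LipschitzOnWith.of_dist_le_mul fun s hs t ht => by
      simpa [Real.dist_eq] using hψ s hs t ht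
    exact this.continuousOn
  refine ⟨A, hA, hAsub, fun k hk hkA t ht => ?_⟩
  by_cases htA : t ∈ A
  · exact hkA htA
  obtain ⟨p, ⟨hpA, hpt⟩, hp⟩ := Set.exists_max_image (A ∩ Iic t) id
    (hA.subset inter_subset_left) ⟨α, Or.inl (Or.inl rfl), ht.1⟩
  obtain ⟨q, ⟨hqA, htq⟩, hq⟩ := Set.exists_min_image (A ∩ Ici t) id
    (hA.subset inter_subset_left) ⟨β, Or.inl (Or.inr rfl), ht.2⟩
  have hpt : p < t := lt_of_le_of_ne hpt fun h => htA (h ▸ hpA)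
  have htq : t < q := lt_of_le_of_ne htq fun h => htA (h ▸ hqA)
  have hpI := hAsub hpA
  have hqI := hAsub hqA
  have hseg : ∀ c ∈ Icc (0 : ℝ) 1, AffineMap.lineMap p q c ∈ Icc α β := fun c hc => by
    have := (convex_Icc α β).lineMap_mem hpI hqI hc
    exact this
  have hiso : dist (ψ p) (ψ q) = q - p := by
    rw [dist_eq_of_sameSign (hψc.comp AffineMap.lineMap_continuous.continuousOn hseg) hS hI
      (fun c hc => hψS _ (hseg c hc)), dist_comm, Real.dist_eq, abs_of_pos (by linarith)]
    intro I h J h' j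
    have e : ∀ c : ℝ, (I c - J c) j = (1 - c) * (I 0 - J 0) j + c * (I 1 - J 1) j := by
      intro c
      have e1 := Isometry.map_lineMap (hI I h) 0 1 c
      have e2 := Isometry.map_lineMap (hI J h') 0 1 c
      simp only [AffineMap.lineMap_apply_module, smul_eq_mul, mul_zero, mul_one, zero_add] at e1 e2
      rw [e1, e2]
      simp only [PiLp.sub_apply, PiLp.add_apply, PiLp.smul_apply, smul_eq_mul]
      ring
    by_contra hns
    rw [e p, e q] at hns
    obtain ⟨h1, h2⟩ := exists_root_of_not_sameSign (hpt.trans htq) hns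
    have hr : root (I, J, j) ∈ A := Or.inr ⟨⟨_, ⟨h, h', trivial⟩, rfl⟩,
      hpI.1.trans h1.le, le_trans h2.le hqI.2⟩
    rcases le_total (root (I, J, j)) t with h3 | h3
    · exact absurd (hp _ ⟨hr, h3⟩) (not_le.2 h1)
    · exact absurd (hq _ ⟨hr, h3⟩) (not_le.2 h2)
  have hab : ∀ k : ℝ → EuclideanSpace ℝ (Fin n),
      (∀ s ∈ Icc α β, ∀ t ∈ Icc α β, dist (k s) (k t) ≤ |s - t|) →
      dist (k p) (k t) ≤ t - p ∧ dist (k t) (k q) ≤ q - t := fun k hk =>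
    ⟨(hk p hpI t ht).trans (by rw [abs_sub_comm, abs_of_pos (by linarith)]),
      (hk t ht q hqI).trans (by rw [abs_sub_comm, abs_of_pos (by linarith)])⟩
  rw [eq_lineMap_of_short hpt htq (hab ψ hψ).1 (hab ψ hψ).2 hiso,
    eq_lineMap_of_short hpt htq (hab k hk).1 (hab k hk).2 (by rw [hkA hpA, hkA hqA, hiso]),
    hkA hpA, hkA hqA]

lemma exists_locallyConst_real (C : Finset ℝ) : ∀ {δ : ℝ}, 0 < δ → ∃ r > 0, ∃ ψ : ℝ → ℝ,
    (∀ s t, |ψ s - ψ t| ≤ |s - t|) ∧ (∀ t, |ψ t - t| ≤ δ) ∧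
    ∀ c ∈ C, ∀ t, |t - c| ≤ r → ψ t = ψ c := by
  classical
  induction C using Finset.induction_on with
  | empty => exact fun hδ => ⟨1, one_pos, id, by simp, by simp [hδ.le], by simp⟩
  | insert c C _ ih =>
    intro δ hδ
    obtain ⟨r, hr, ψ, h1, h2, h3⟩ := ih (half_pos hδ)
    set r' := min r (δ / 2)
    have hr' : 0 < r' := lt_min hr (half_pos hδ)
    -- the soft threshold at `ψ c`, constant on the interval of radius `r'`
    set σ : ℝ → ℝ := fun t => max (t - r') (min (t + r') (ψ c))
    refine ⟨r', hr', σ ∘ ψ, fun s t => ?_, fun t => ?_, fun d hd t ht => ?_⟩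
    · refine le_trans ?_ (h1 s t)
      refine (abs_max_sub_max_le_max _ _ _ _).trans (max_le (by simp) ?_)
      exact (abs_min_sub_min_le_max _ _ _ _).trans (max_le (by simp) (by simp))
    · have h4 : |σ (ψ t) - ψ t| ≤ r' := by
        rw [abs_le]
        refine ⟨by linarith [le_max_left (ψ t - r') (min (ψ t + r') (ψ c))], ?_⟩
        have : σ (ψ t) ≤ ψ t + r' := max_le (by linarith) (min_le_left _ _)
        linarith
      have h5 := abs_sub_le (σ (ψ t)) (ψ t) t
      have := h2 t
      have : r' ≤ δ / 2 := min_le_right _ _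
      simp only [Function.comp_apply]
      linarith
    · rcases Finset.mem_insert.1 hd with rfl | hd
      · have hconst : ∀ t, |t - d| ≤ r' → σ (ψ t) = ψ d := fun t ht => by
          have := abs_le.1 ((h1 t d).trans ht)
          simp only [σ]
          rw [min_eq_right (by linarith), max_eq_right (by linarith)]
        rw [Function.comp_apply, Function.comp_apply, hconst t ht, hconst d (by simpa using hr'.le)]
      · rw [Function.comp_apply, h3 d hd t (ht.trans (min_le_left _ _)), Function.comp_apply]

/-- The identity of a Euclidean space can be approximated by non-expanding maps which are constant
near each of finitely many given points. -/
lemma exists_locallyConst {n : ℕ} (C : Finset (EuclideanSpace ℝ (Fin n))) {δ : ℝ} (hδ : 0 < δ) :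
    ∃ r > 0, ∃ ψ : EuclideanSpace ℝ (Fin n) → EuclideanSpace ℝ (Fin n),
      (∀ x y, dist (ψ x) (ψ y) ≤ dist x y) ∧ (∀ x, dist (ψ x) x ≤ δ) ∧
      ∀ c ∈ C, ∀ x, dist x c ≤ r → ψ x = ψ c := by
  classical
  have hδ' : 0 < δ / (n + 1) := by positivity
  obtain ⟨r, hr, ψ, h1, h2, h3⟩ := exists_locallyConst_real
    (C.biUnion fun c => Finset.univ.image fun i => c i) hδ'
  refine ⟨r, hr, fun x => WithLp.toLp 2 fun i => ψ (x i), fun x y => ?_, fun x => ?_,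
    fun c hc x hx => ?_⟩
  · rw [EuclideanSpace.dist_eq, EuclideanSpace.dist_eq]
    exact Real.sqrt_le_sqrt (Finset.sum_le_sum fun i _ => pow_le_pow_left₀ dist_nonneg (h1 _ _) 2)
  · rw [EuclideanSpace.dist_eq]
    refine Real.sqrt_le_iff.2 ⟨hδ.le, ?_⟩
    refine (Finset.sum_le_card_nsmul _ _ ((δ / (n + 1)) ^ 2) fun i _ =>
      pow_le_pow_left₀ dist_nonneg (h2 _) 2).trans ?_
    rw [Finset.card_univ, Fintype.card_fin, nsmul_eq_mul, div_pow, ← mul_div_assoc,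
      div_le_iff₀ (by positivity), mul_comm]
    have : (0 : ℝ) ≤ n := n.cast_nonneg
    exact mul_le_mul_of_nonneg_left (by nlinarith) (sq_nonneg _)
  · have : ∀ i, ψ (x i) = ψ (c i) := fun i => by
      refine h3 _ (Finset.mem_biUnion.2 ⟨c, hc, Finset.mem_image_of_mem _ (Finset.mem_univ _)⟩) _ ?_
      rw [← Real.norm_eq_abs]
      exact (PiLp.norm_apply_le (x - c) i).trans (by rwa [← dist_eq_norm])
    simp only [this]

/-! ### Barycentric coordinates -/

/-- The total mass of a system of weights. -/
noncomputable def mass (V : Type*) : (V →₀ ℝ) →ₗ[ℝ] ℝ := Finsupp.linearCombination ℝ fun _ => 1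

lemma mass_eq_sum {V : Type*} (w : V →₀ ℝ) : mass V w = w.sum fun _ a => a := by
  simp [mass, Finsupp.linearCombination_apply]

lemma mass_single {V : Type*} (v : V) (r : ℝ) : mass V (Finsupp.single v r) = r := by
  simp [mass]

lemma linearCombination_eq_sum {V E : Type*} [AddCommGroup E] [Module ℝ E] (p : V → E)
    {w : V →₀ ℝ} {s : Finset V} (h : w.support ⊆ s) :
    Finsupp.linearCombination ℝ p w = ∑ v ∈ s, w v • p v := by
  rw [Finsupp.linearCombination_apply]
  exact Finsupp.sum_of_support_subset _ h _ (by simp)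

lemma mass_eq_sum_finset {V : Type*} {w : V →₀ ℝ} {s : Finset V} (h : w.support ⊆ s) :
    mass V w = ∑ v ∈ s, w v := by
  simpa [mass] using linearCombination_eq_sum (fun _ : V => (1 : ℝ)) h

lemma linearCombination_linearCombination {V E : Type*} [AddCommGroup E] [Module ℝ E] (p : V → E)
    (q : V → V →₀ ℝ) (w : V →₀ ℝ) :
    Finsupp.linearCombination ℝ p (Finsupp.linearCombination ℝ q w) =
      Finsupp.linearCombination ℝ (fun v => Finsupp.linearCombination ℝ p (q v)) w := by
  induction w using Finsupp.induction_linear with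
  | zero => simp
  | add f g hf hg => simp [hf, hg]
  | single v r => simp

lemma linearCombination_congr {V E : Type*} [AddCommGroup E] [Module ℝ E] {p q : V → E}
    {w : V →₀ ℝ} (h : ∀ v ∈ w.support, p v = q v) :
    Finsupp.linearCombination ℝ p w = Finsupp.linearCombination ℝ q w := by
  rw [Finsupp.linearCombination_apply, Finsupp.linearCombination_apply]
  exact Finset.sum_congr rfl fun v hv => by simp only [h v hv]

lemma linearCombination_mapDomain_indicator {V E : Type*} [AddCommGroup E] [Module ℝ E]
    (p : V → E) {s : Finset V} (t : Finset s) (w : s → ℝ) :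
    Finsupp.linearCombination ℝ p
      (Finsupp.mapDomain Subtype.val (Finsupp.indicator t fun v _ => w v)) =
      ∑ v ∈ t, w v • p v := by
  rw [Finsupp.linearCombination_mapDomain,
    linearCombination_eq_sum _ (Finsupp.support_indicator_subset _ _)]
  exact Finset.sum_congr rfl fun v hv => by simp [Finsupp.indicator_of_mem hv]

lemma affineIndependent_iff_finsupp {V E : Type*} [AddCommGroup E] [Module ℝ E] {p : V → E}
    {s : Finset V} : AffineIndependent ℝ (fun v : s => p v) ↔ ∀ w : V →₀ ℝ, w.support ⊆ s →
      mass V w = 0 → Finsupp.linearCombination ℝ p w = 0 → w = 0 := by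
  classical
  rw [affineIndependent_iff]
  constructor
  · intro h w hw h0 h1
    ext v
    by_cases hv : v ∈ s
    · refine h Finset.univ (fun v => w v) ?_ ?_ ⟨v, hv⟩ (Finset.mem_univ _)
      · rw [mass_eq_sum_finset hw, ← Finset.sum_coe_sort] at h0
        exact h0
      · rw [linearCombination_eq_sum p hw, ← Finset.sum_coe_sort] at h1
        exact h1
    · exact Finsupp.notMem_support_iff.1 fun h => hv (hw h)
  · intro h t w h0 h1 v hv
    set w' : V →₀ ℝ := Finsupp.mapDomain Subtype.val (Finsupp.indicator t fun v _ => w v)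
    have hw' : w' = 0 := by
      refine h w' (fun x hx => ?_) ?_ ?_
      · obtain ⟨y, -, rfl⟩ := Finset.mem_image.1 (Finsupp.mapDomain_support hx)
        exact y.2
      · rw [mass, linearCombination_mapDomain_indicator]; simpa using h0
      · rw [linearCombination_mapDomain_indicator]; exact h1
    have := DFunLike.congr_fun hw' v.1
    rwa [Finsupp.mapDomain_apply Subtype.val_injective, Finsupp.indicator_of_mem hv] at this

namespace Triangulation

variable {P : Type*} [MetricSpace P]

/-- The barycentric coordinates of a point, as a system of weights on the vertices. -/
noncomputable def bary (T : Triangulation P) (x : P) : P →₀ ℝ := (T.coord x).1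

section Basic

variable (T : Triangulation P)

lemma bary_nonneg (x v : P) : 0 ≤ T.bary x v := (T.coord x).2.1 v

lemma mass_bary (x : P) : mass P (T.bary x) = 1 := by
  rw [mass_eq_sum]; exact (T.coord x).2.2.1

lemma support_bary_mem (x : P) : (T.bary x).support ∈ T.faces := (T.coord x).2.2.2

lemma bary_injective : Function.Injective T.bary := fun _ _ h =>
  T.coord.injective (Subtype.ext h)

lemma exists_bary_eq {w : P →₀ ℝ} (h0 : ∀ v, 0 ≤ w v) (h1 : mass P w = 1)
    (h2 : w.support ∈ T.faces) : ∃ x, T.bary x = w :=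
  ⟨T.coord.symm ⟨w, h0, by rw [← mass_eq_sum, h1], h2⟩,
    congrArg Subtype.val (T.coord.apply_symm_apply _)⟩

variable {T}

lemma mem_simplex {s : Finset P} {x : P} : x ∈ T.simplex s ↔ (T.bary x).support ⊆ s := Iff.rfl

lemma nonempty_of_mem {s : Finset P} (hs : s ∈ T.faces) : s.Nonempty :=
  (T.isRelLowerSet_faces hs).1

lemma mem_faces_of_subset {s t : Finset P} (hs : s ∈ T.faces) (h : t ⊆ s) (ht : t.Nonempty) :
    t ∈ T.faces := (T.isRelLowerSet_faces hs).2 h ht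

lemma singleton_mem {s : Finset P} (hs : s ∈ T.faces) {v : P} (hv : v ∈ s) : {v} ∈ T.faces :=
  mem_faces_of_subset hs (by simpa using hv) (Finset.singleton_nonempty v)

lemma bary_vertex {s : Finset P} (hs : s ∈ T.faces) {v : P} (hv : v ∈ s) :
    T.bary v = Finsupp.single v 1 := T.coord_vertex v (singleton_mem hs hv)

lemma vertex_mem_simplex {s : Finset P} (hs : s ∈ T.faces) {v : P} (hv : v ∈ s) :
    v ∈ T.simplex s := by
  rw [mem_simplex, bary_vertex hs hv]
  exact Finsupp.support_single_subset.trans (by simpa using hv)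

lemma sum_bary {s : Finset P} {x : P} (hx : x ∈ T.simplex s) : ∑ v ∈ s, T.bary x v = 1 := by
  rw [← mass_eq_sum_finset (mem_simplex.1 hx), mass_bary]

lemma exists_isometric_linearCombination {s : Finset P} (hs : s ∈ T.faces) :
    ∃ (n : ℕ) (p : P → EuclideanSpace ℝ (Fin n)), AffineIndependent ℝ (fun v : s => p v) ∧
      ∀ y ∈ T.simplex s, ∀ z ∈ T.simplex s, dist y z =
        dist (Finsupp.linearCombination ℝ p (T.bary y))
          (Finsupp.linearCombination ℝ p (T.bary z)) := by
  obtain ⟨n, p, hp, hd⟩ := T.isometric s hs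
  refine ⟨n, p, hp, fun y hy z hz => ?_⟩
  rw [linearCombination_eq_sum p (mem_simplex.1 hy), linearCombination_eq_sum p (mem_simplex.1 hz)]
  exact hd y z hy hz

end Basic

/-! ### Refinements -/

/-- `T'` refines `T`: the barycentric coordinates with respect to `T` are linear in those with
respect to `T'`. -/
def Refines (T' T : Triangulation P) : Prop :=
  ∀ z, T.bary z = Finsupp.linearCombination ℝ T.bary (T'.bary z)

lemma Refines.refl (T : Triangulation P) : T.Refines T := by
  intro z
  rw [linearCombination_congr (q := fun v => Finsupp.single v 1) fun v hv =>
    bary_vertex (T.support_bary_mem z) hv, Finsupp.linearCombination_apply]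
  simp

lemma Refines.trans {T'' T' T : Triangulation P} (h : T''.Refines T') (h' : T'.Refines T) :
    T''.Refines T := by
  intro z
  rw [h' z, h z, linearCombination_linearCombination]
  exact linearCombination_congr fun v _ => (h' v).symm

lemma Refines.bary_apply {T' T : Triangulation P} (h : T'.Refines T) (z v : P) :
    T.bary z v = ∑ u ∈ (T'.bary z).support, T'.bary z u * T.bary u v := by
  conv_lhs => rw [h z]
  rw [Finsupp.linearCombination_apply, Finsupp.sum, Finsupp.finsetSum_apply]
  simp

lemma Refines.vertex_mem_simplex {T' T : Triangulation P} (h : T'.Refines T) {s : Finset P} {z : P}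
    (hz : z ∈ T.simplex s) {u : P} (hu : u ∈ (T'.bary z).support) : u ∈ T.simplex s := by
  intro v hv
  refine hz ?_
  change v ∈ (T.bary z).support
  rw [Finsupp.mem_support_iff, h.bary_apply]
  have hpos : ∀ x v, 0 ≤ T.bary x v := T.bary_nonneg
  refine ne_of_gt (Finset.sum_pos' (fun x _ => mul_nonneg (T'.bary_nonneg _ _) (hpos _ _))
    ⟨u, hu, mul_pos ?_ ?_⟩)
  · exact lt_of_le_of_ne (T'.bary_nonneg _ _) (Finsupp.mem_support_iff.1 hu).symm
  · exact lt_of_le_of_ne (hpos _ _) (Finsupp.mem_support_iff.1 hv).symm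

lemma Refines.mem_simplex_of_forall {T' T : Triangulation P} (h : T'.Refines T) {s : Finset P}
    {z : P} (hz : ∀ u ∈ (T'.bary z).support, u ∈ T.simplex s) : z ∈ T.simplex s := by
  intro v hv
  by_contra hvs
  refine Finsupp.mem_support_iff.1 hv ((h.bary_apply z v).trans (Finset.sum_eq_zero fun u hu => ?_))
  rw [show T.bary u v = 0 from Finsupp.notMem_support_iff.1 fun h' => hvs (hz u hu h'), mul_zero]

lemma Refines.exists_simplex_subset {T' T : Triangulation P} (h : T'.Refines T) {t' : Finset P}
    (ht' : t' ∈ T'.faces) : ∃ t ∈ T.faces, T'.simplex t' ⊆ T.simplex t := by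
  classical
  have hne := nonempty_of_mem ht'
  have hcard : (0 : ℝ) < t'.card := by exact_mod_cast hne.card_pos
  -- the barycentre of `t'` determines the simplex of `T` containing `t'`
  set w : P →₀ ℝ := Finsupp.indicator t' fun _ _ => (t'.card : ℝ)⁻¹
  have hw : ∀ v ∈ t', w v = (t'.card : ℝ)⁻¹ := fun v hv => Finsupp.indicator_of_mem hv _
  have hws : w.support = t' := by
    ext v
    by_cases hv : v ∈ t'
    · simp [hw v hv, hv, hcard.ne']
    · simp [w, hv]
  obtain ⟨z, hz⟩ := T'.exists_bary_eq (w := w) (fun v => by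
      by_cases hv : v ∈ t'
      · rw [hw v hv]; positivity
      · simp [w, hv]) (by
      rw [mass_eq_sum_finset hws.le, Finset.sum_congr rfl hw, Finset.sum_const, nsmul_eq_mul,
        mul_inv_cancel₀ hcard.ne']) (by rwa [hws])
  refine ⟨_, T.support_bary_mem z, fun y hy => h.mem_simplex_of_forall fun u hu => ?_⟩
  refine h.vertex_mem_simplex (z := z) (fun _ h => h) ?_
  rw [hz, hws]
  exact hy hu

lemma Refines.linearCombination_eq {T' T : Triangulation P} (h : T'.Refines T) {s : Finset P}
    {φ c : P → ℝ} (hφ : ∀ z ∈ T.simplex s, φ z = Finsupp.linearCombination ℝ c (T.bary z)) {z : P}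
    (hz : z ∈ T.simplex s) : φ z = Finsupp.linearCombination ℝ φ (T'.bary z) := by
  rw [hφ z hz, h z, linearCombination_linearCombination]
  exact linearCombination_congr fun v hv => (hφ v (h.vertex_mem_simplex hz hv)).symm

end Triangulation

namespace Triangulation

/-! ### Subdividing an edge -/

section Star

variable {P : Type*} [MetricSpace P]

/-- Expresses weights involving the new vertex `x`, with coordinates `ξ`, by the old vertices. -/
noncomputable def unstar (x : P) (ξ : P →₀ ℝ) (w : P →₀ ℝ) : P →₀ ℝ :=
  w + w x • (ξ - Finsupp.single x 1)

/-- Replaces as much as possible of the weights of `a` and `b` by weight of the new vertex `x`,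
whose coordinates are `ξ`. -/
noncomputable def star (a b x : P) (ξ : P →₀ ℝ) (w : P →₀ ℝ) : P →₀ ℝ :=
  w + min (w a / ξ a) (w b / ξ b) • (Finsupp.single x 1 - ξ)

open Classical in
omit [MetricSpace P] in
lemma linearCombination_unstar {E : Type*} [AddCommGroup E] [Module ℝ E] (p : P → E) {x : P}
    (ξ w : P →₀ ℝ) : Finsupp.linearCombination ℝ p (unstar x ξ w) =
      Finsupp.linearCombination ℝ
        (fun v => if v = x then Finsupp.linearCombination ℝ p ξ else p v) w := by
  induction w using Finsupp.induction_linear with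
  | zero => simp [unstar]
  | add f g hf hg =>
    rw [map_add, ← hf, ← hg, ← map_add]
    congr 1
    simp only [unstar, Finsupp.add_apply]
    module
  | single v r =>
    rw [Finsupp.linearCombination_single]
    by_cases hv : v = x
    · subst hv; simp [unstar, smul_sub]
    · simp [unstar, hv]

variable {T : Triangulation P} {a b x : P}

lemma mass_unstar (T : Triangulation P) (x : P) (w : P →₀ ℝ) :
    mass P (unstar x (T.bary x) w) = mass P w := by
  rw [unstar, map_add, map_smul, map_sub, mass_bary, mass_single, sub_self, smul_zero, add_zero]

lemma mass_star (T : Triangulation P) (a b x : P) (w : P →₀ ℝ) :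
    mass P (star a b x (T.bary x) w) = mass P w := by
  rw [star, map_add, map_smul, map_sub, mass_bary, mass_single, sub_self, smul_zero, add_zero]

/-- The point `x` lies in the open edge of `T` with end points `a` and `b`. -/
structure IsEdgePoint (T : Triangulation P) (a b x : P) : Prop where
  ne : a ≠ b
  support_eq : ∀ v, v ∈ (T.bary x).support ↔ v = a ∨ v = b

namespace IsEdgePoint

variable (h : IsEdgePoint T a b x)

include h

lemma pos_left : 0 < T.bary x a :=
  lt_of_le_of_ne (T.bary_nonneg _ _)
    (Finsupp.mem_support_iff.1 ((h.support_eq a).2 (Or.inl rfl))).symm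

lemma pos_right : 0 < T.bary x b :=
  lt_of_le_of_ne (T.bary_nonneg _ _)
    (Finsupp.mem_support_iff.1 ((h.support_eq b).2 (Or.inr rfl))).symm

lemma notMem_of_mem_faces {s : Finset P} (hs : s ∈ T.faces) : x ∉ s := by
  intro hx
  classical
  have e := bary_vertex hs hx
  have ha := h.pos_left
  have hb := h.pos_right
  rw [e, Finsupp.single_apply] at ha hb
  refine h.ne ?_
  have h1 : x = a := by by_contra h1; simp [h1] at ha
  have h2 : x = b := by by_contra h2; simp [h2] at hb
  exact h1.symm.trans h2

lemma ne_left : x ≠ a := fun e =>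
  h.notMem_of_mem_faces (T.support_bary_mem x) ((h.support_eq x).2 (Or.inl e))

lemma ne_right : x ≠ b := fun e =>
  h.notMem_of_mem_faces (T.support_bary_mem x) ((h.support_eq x).2 (Or.inr e))

lemma bary_self : T.bary x x = 0 :=
  Finsupp.notMem_support_iff.1 (h.notMem_of_mem_faces (T.support_bary_mem x))

lemma bary_of_ne {v : P} (ha : v ≠ a) (hb : v ≠ b) : T.bary x v = 0 :=
  Finsupp.notMem_support_iff.1 fun hv => ((h.support_eq v).1 hv).elim ha hb

lemma unstar_star {w : P →₀ ℝ} (hw : w.support ∈ T.faces) :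
    unstar x (T.bary x) (star a b x (T.bary x) w) = w := by
  have hx : w x = 0 := Finsupp.notMem_support_iff.1 (h.notMem_of_mem_faces hw)
  have : star a b x (T.bary x) w x = min (w a / T.bary x a) (w b / T.bary x b) := by
    simp [star, hx, h.bary_self]
  rw [unstar, this, star]
  module

lemma star_unstar {w : P →₀ ℝ} (hw : ∀ v, 0 ≤ w v) (hab : w a = 0 ∨ w b = 0) :
    star a b x (T.bary x) (unstar x (T.bary x) w) = w := by
  have ha : unstar x (T.bary x) w a / T.bary x a = w a / T.bary x a + w x := by
    have := h.pos_left
    simp only [unstar, Finsupp.add_apply, Finsupp.smul_apply, Finsupp.sub_apply,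
      Finsupp.single_eq_of_ne h.ne_left.symm, smul_eq_mul, sub_zero]
    field_simp
  have hb : unstar x (T.bary x) w b / T.bary x b = w b / T.bary x b + w x := by
    have := h.pos_right
    simp only [unstar, Finsupp.add_apply, Finsupp.smul_apply, Finsupp.sub_apply,
      Finsupp.single_eq_of_ne h.ne_right.symm, smul_eq_mul, sub_zero]
    field_simp
  have hm : min (w a / T.bary x a + w x) (w b / T.bary x b + w x) = w x := by
    have h1 := div_nonneg (hw a) h.pos_left.le
    have h2 := div_nonneg (hw b) h.pos_right.le
    rcases hab with h0 | h0
    · rw [h0, zero_div, zero_add, min_eq_left (by linarith)]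
    · rw [h0, zero_div, zero_add, min_eq_right (by linarith)]
  rw [star, ha, hb, hm, unstar]
  module

lemma unstar_nonneg {w : P →₀ ℝ} (hw : ∀ v, 0 ≤ w v) (v : P) :
    0 ≤ unstar x (T.bary x) w v := by
  by_cases hv : v = x
  · subst hv; simp [unstar, h.bary_self]
  · have : unstar x (T.bary x) w v = w v + w x * T.bary x v := by
      simp [unstar, Ne.symm hv]
    rw [this]
    exact add_nonneg (hw v) (mul_nonneg (hw x) (T.bary_nonneg x v))

lemma star_nonneg {w : P →₀ ℝ} (hw : ∀ v, 0 ≤ w v) (v : P) :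
    0 ≤ star a b x (T.bary x) w v := by
  have e : star a b x (T.bary x) w v = w v +
      min (w a / T.bary x a) (w b / T.bary x b) * (Finsupp.single x (1 : ℝ) v - T.bary x v) := by
    simp [star]
  have hm : 0 ≤ min (w a / T.bary x a) (w b / T.bary x b) :=
    le_min (div_nonneg (hw a) h.pos_left.le) (div_nonneg (hw b) h.pos_right.le)
  have hs : 0 ≤ Finsupp.single x (1 : ℝ) v := by
    classical
    rw [Finsupp.single_apply]
    split_ifs <;> norm_num
  have hle : min (w a / T.bary x a) (w b / T.bary x b) * T.bary x v ≤ w v := by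
    by_cases ha : v = a
    · subst ha; exact (le_div_iff₀ h.pos_left).1 (min_le_left _ _)
    by_cases hb : v = b
    · subst hb; exact (le_div_iff₀ h.pos_right).1 (min_le_right _ _)
    rw [h.bary_of_ne ha hb, mul_zero]; exact hw v
  rw [e]
  nlinarith [mul_nonneg hm hs]

lemma star_left_or_right {w : P →₀ ℝ} :
    star a b x (T.bary x) w a = 0 ∨ star a b x (T.bary x) w b = 0 := by
  rcases min_choice (w a / T.bary x a) (w b / T.bary x b) with hm | hm
  · left
    have := h.pos_left.ne'
    simp [star, hm, h.ne_left, this]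
  · right
    have := h.pos_right.ne'
    simp [star, hm, h.ne_right, this]

open Classical in
/-- A face `t` of the subdivision lies in a face of `T`: the new vertex `x`, if present, is to be
replaced by both `a` and `b`. -/
lemma support_unstar_subset {w : P →₀ ℝ} {t : Finset P} (hw : w.support ⊆ t) :
    (unstar x (T.bary x) w).support ⊆ if x ∈ t then t.erase x ∪ {a, b} else t := by
  intro v hv
  rw [Finsupp.mem_support_iff] at hv
  by_cases hx : x ∈ t
  · rw [if_pos hx, Finset.mem_union, Finset.mem_erase, Finset.mem_insert, Finset.mem_singleton]
    by_contra hc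
    push Not at hc
    refine hv ?_
    by_cases hvx : v = x
    · subst hvx; simp [unstar, h.bary_self]
    · have : w v = 0 := Finsupp.notMem_support_iff.1 fun h' => hc.1 hvx (hw h')
      simp [unstar, this, h.bary_of_ne hc.2.1 hc.2.2, Ne.symm hvx]
  · rw [if_neg hx]
    have : w x = 0 := Finsupp.notMem_support_iff.1 fun h' => hx (hw h')
    refine hw (Finsupp.mem_support_iff.2 ?_)
    simpa [unstar, this] using hv

end IsEdgePoint

open Classical in
/-- The faces of the subdivision of the edge `{a, b}` of `T` at its point `x`: the sets that do not
contain both `a` and `b`, and that span, when `x` is replaced by `a` and `b`, a face of `T`. -/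
def starFaces (T : Triangulation P) (a b x : P) : Set (Finset P) :=
  {t | t.Nonempty ∧ (a ∉ t ∨ b ∉ t) ∧ (if x ∈ t then t.erase x ∪ {a, b} else t) ∈ T.faces}

open Classical in
lemma IsEdgePoint.support_star_mem (h : IsEdgePoint T a b x) {w : P →₀ ℝ} (hw : ∀ v, 0 ≤ w v)
    (h1 : mass P w = 1) (h2 : w.support ∈ T.faces) :
    (star a b x (T.bary x) w).support ∈ starFaces T a b x := by
  refine ⟨?_, ?_, ?_⟩
  · rw [Finsupp.support_nonempty_iff]
    intro h0
    have := mass_star T a b x w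
    rw [h0, map_zero, h1] at this
    exact zero_ne_one this
  · simpa [Finsupp.notMem_support_iff] using h.star_left_or_right (w := w)
  · have hx : w x = 0 := Finsupp.notMem_support_iff.1 (h.notMem_of_mem_faces h2)
    have hxs : star a b x (T.bary x) w x = min (w a / T.bary x a) (w b / T.bary x b) := by
      simp [star, hx, h.bary_self]
    by_cases h0 : min (w a / T.bary x a) (w b / T.bary x b) = 0
    · rw [if_neg (by rw [Finsupp.notMem_support_iff, hxs, h0]), star, h0, zero_smul, add_zero]
      exact h2
    · rw [if_pos (by rwa [Finsupp.mem_support_iff, hxs])]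
      have ha : w a ≠ 0 := fun e => h0 (by
        rw [e, zero_div]; exact min_eq_left (div_nonneg (hw b) h.pos_right.le))
      have hb : w b ≠ 0 := fun e => h0 (by
        rw [e, zero_div]; exact min_eq_right (div_nonneg (hw a) h.pos_left.le))
      refine mem_faces_of_subset h2 (fun v hv => ?_) ⟨a, by simp⟩
      rw [Finset.mem_union, Finset.mem_erase, Finset.mem_insert, Finset.mem_singleton] at hv
      rw [Finsupp.mem_support_iff]
      by_cases hva : v = a
      · rwa [hva]
      by_cases hvb : v = b
      · rwa [hvb]
      obtain ⟨hvx, hv⟩ := hv.resolve_right (by tauto)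
      rw [Finsupp.mem_support_iff] at hv
      simpa [star, h.bary_of_ne hva hvb, Ne.symm hvx] using hv

open Classical in
lemma IsEdgePoint.support_unstar_mem (h : IsEdgePoint T a b x) {w : P →₀ ℝ}
    (h1 : mass P w = 1) {t : Finset P} (ht : t ∈ starFaces T a b x) (hw : w.support ⊆ t) :
    (unstar x (T.bary x) w).support ∈ T.faces := by
  refine mem_faces_of_subset ht.2.2 (h.support_unstar_subset hw) ?_
  rw [Finsupp.support_nonempty_iff]
  intro h0
  have := mass_unstar T x w
  rw [h0, map_zero, h1] at this
  exact zero_ne_one this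

open Classical in
/-- The abstract complex of the subdivision of the edge `{a, b}` at its point `x`. -/
def starComplex (T : Triangulation P) (a b x : P) : PreAbstractSimplicialComplex P where
  faces := starFaces T a b x
  isRelLowerSet_faces := by
    rintro t ⟨h1, h2, h3⟩
    refine ⟨h1, fun u hu hne => ⟨hne, h2.imp (fun h' h'' => h' (hu h''))
      (fun h' h'' => h' (hu h'')), mem_faces_of_subset h3 ?_ ?_⟩⟩
    · by_cases hx : x ∈ u
      · rw [if_pos hx, if_pos (hu hx)]
        exact Finset.union_subset_union (Finset.erase_subset_erase _ hu) subset_rfl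
      · rw [if_neg hx]
        split_ifs
        · exact fun v hv => Finset.mem_union_left _
            (Finset.mem_erase.2 ⟨fun e => hx (e ▸ hv), hu hv⟩)
        · exact hu
    · split_ifs
      · exact ⟨a, by simp⟩
      · exact hne

open Classical in
omit [MetricSpace P] in
lemma mem_of_mem_starFaces {t : Finset P} {v : P} (hv : v ∈ t) (hvx : v ≠ x) :
    v ∈ if x ∈ t then t.erase x ∪ {a, b} else t := by
  split_ifs
  · exact Finset.mem_union_left _ (Finset.mem_erase.2 ⟨hvx, hv⟩)
  · exact hv

lemma finite_starFaces (T : Triangulation P) (a b x : P) : (starFaces T a b x).Finite := by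
  classical
  refine (T.finite_faces.biUnion fun u _ => Set.toFinite
    ((insert x u).powerset : Set (Finset P))).subset fun t ht => ?_
  refine mem_biUnion ht.2.2 ?_
  rw [Finset.mem_coe, Finset.mem_powerset]
  intro v hv
  by_cases hvx : v = x
  · exact Finset.mem_insert.2 (Or.inl hvx)
  · exact Finset.mem_insert_of_mem (mem_of_mem_starFaces hv hvx)

/-- The barycentric coordinates of the subdivision of the edge `{a, b}` at its point `x`. -/
noncomputable def starCoord (h : IsEdgePoint T a b x) : P ≃ Realization (starComplex T a b x) :=
  have key (w : Realization (starComplex T a b x)) : (∀ v, 0 ≤ unstar x (T.bary x) w.1 v) ∧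
      ((unstar x (T.bary x) w.1).sum fun _ a => a) = 1 ∧
      (unstar x (T.bary x) w.1).support ∈ T.faces :=
    ⟨h.unstar_nonneg w.2.1, by rw [← mass_eq_sum, mass_unstar, mass_eq_sum]; exact w.2.2.1,
      h.support_unstar_mem (by rw [mass_eq_sum]; exact w.2.2.1) w.2.2.2 subset_rfl⟩
  { toFun := fun z => ⟨star a b x (T.bary x) (T.bary z), h.star_nonneg (T.bary_nonneg z),
      by rw [← mass_eq_sum, mass_star, mass_bary],
      h.support_star_mem (T.bary_nonneg z) (T.mass_bary z) (T.support_bary_mem z)⟩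
    invFun := fun w => T.coord.symm ⟨unstar x (T.bary x) w.1, key w⟩
    left_inv := fun z => by
      refine (Equiv.symm_apply_eq _).2 ?_
      exact Subtype.ext (h.unstar_star (T.support_bary_mem z))
    right_inv := fun w => by
      refine Subtype.ext ?_
      have e : T.bary (T.coord.symm ⟨unstar x (T.bary x) w.1, key w⟩) =
          unstar x (T.bary x) w.1 := congrArg Subtype.val (T.coord.apply_symm_apply _)
      have hw : w.1.support ∈ starFaces T a b x := w.2.2.2
      change star a b x (T.bary x) (T.bary _) = w.1
      rw [e, h.star_unstar w.2.1]
      have := hw.2.1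
      rwa [Finsupp.notMem_support_iff, Finsupp.notMem_support_iff] at this }

lemma IsEdgePoint.star_vertex (h : IsEdgePoint T a b x) {v : P} (hv : {v} ∈ starFaces T a b x) :
    star a b x (T.bary x) (T.bary v) = Finsupp.single v 1 := by
  classical
  by_cases hvx : v = x
  · subst hvx
    rw [star, div_self h.pos_left.ne', div_self h.pos_right.ne', min_self, one_smul]
    abel
  · have hv' : {v} ∈ T.faces := by
      have := hv.2.2
      rwa [if_neg (by simpa using Ne.symm hvx)] at this
    have e : T.bary v = _ := T.coord_vertex v hv'
    have hm : min (T.bary v a / T.bary x a) (T.bary v b / T.bary x b) = 0 := by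
      rw [e]
      by_cases hva : v = a
      · subst hva
        rw [Finsupp.single_apply, Finsupp.single_apply, if_pos rfl, if_neg h.ne, zero_div]
        exact min_eq_right (div_nonneg zero_le_one h.pos_left.le)
      · rw [Finsupp.single_apply, Finsupp.single_apply, if_neg hva, zero_div]
        refine min_eq_left (div_nonneg ?_ h.pos_right.le)
        split_ifs <;> norm_num
    rw [star, hm, zero_smul, add_zero, e]

lemma IsEdgePoint.exists_isometric (h : IsEdgePoint T a b x) {t : Finset P}
    (ht : t ∈ starFaces T a b x) :
    ∃ (n : ℕ) (p : P → EuclideanSpace ℝ (Fin n)), AffineIndependent ℝ (fun v : t => p v) ∧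
      ∀ y z : P, (star a b x (T.bary x) (T.bary y)).support ⊆ t →
        (star a b x (T.bary x) (T.bary z)).support ⊆ t →
        dist y z = dist (∑ v ∈ t, star a b x (T.bary x) (T.bary y) v • p v)
          (∑ v ∈ t, star a b x (T.bary x) (T.bary z) v • p v) := by
  classical
  obtain ⟨n, p, hp, hd⟩ := exists_isometric_linearCombination ht.2.2
  set q : P → EuclideanSpace ℝ (Fin n) :=
    fun v => if v = x then Finsupp.linearCombination ℝ p (T.bary x) else p v with hq
  refine ⟨n, q, ?_, fun y z hy hz => ?_⟩
  · rw [affineIndependent_iff_finsupp] at hp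
    refine affineIndependent_iff_finsupp.2 fun w hw h0 h1 => ?_
    rw [← linearCombination_unstar] at h1
    have hz := hp _ (h.support_unstar_subset hw) (by rw [mass_unstar, h0]) h1
    have hx : w x = 0 := by
      rcases ht.2.1 with hc | hc
      · have e : w a = 0 := Finsupp.notMem_support_iff.1 fun h' => hc (hw h')
        have := DFunLike.congr_fun hz a
        simpa [unstar, e, h.ne_left, h.pos_left.ne'] using this
      · have e : w b = 0 := Finsupp.notMem_support_iff.1 fun h' => hc (hw h')
        have := DFunLike.congr_fun hz b
        simpa [unstar, e, h.ne_right, h.pos_right.ne'] using this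
    rwa [unstar, hx, zero_smul, add_zero] at hz
  · have ey := h.unstar_star (T.support_bary_mem y)
    have ez := h.unstar_star (T.support_bary_mem z)
    have sy := h.support_unstar_subset hy
    have sz := h.support_unstar_subset hz
    rw [ey] at sy
    rw [ez] at sz
    rw [← linearCombination_eq_sum q hy, ← linearCombination_eq_sum q hz, hq,
      ← linearCombination_unstar, ← linearCombination_unstar, ey, ez]
    exact hd y sy z sz

/-- The elementary subdivision of `T` at a point `x` of the open edge `{a, b}`. -/
noncomputable def subdivide (T : Triangulation P) (h : IsEdgePoint T a b x) : Triangulation P where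
  toPreAbstractSimplicialComplex := starComplex T a b x
  finite_faces := finite_starFaces T a b x
  coord := starCoord h
  coord_vertex := fun _ hv => h.star_vertex hv
  isometric := fun _ ht => h.exists_isometric ht

lemma subdivide_refines (h : IsEdgePoint T a b x) : (T.subdivide h).Refines T := by
  classical
  intro z
  have e1 : (T.subdivide h).bary z = star a b x (T.bary x) (T.bary z) := rfl
  have e2 := h.unstar_star (T.support_bary_mem z)
  have e3 := linearCombination_unstar (x := x) (fun v : P => Finsupp.single v (1 : ℝ)) (T.bary x)
    (star a b x (T.bary x) (T.bary z))
  have e4 : ∀ w : P →₀ ℝ,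
      Finsupp.linearCombination ℝ (fun v : P => Finsupp.single v (1 : ℝ)) w = w :=
    fun w => by simp [Finsupp.linearCombination_apply]
  rw [e4, e4, e2] at e3
  rw [e1]
  conv_lhs => rw [e3]
  refine linearCombination_congr fun v hv => ?_
  by_cases hvx : v = x
  · rw [if_pos hvx, hvx]
  · rw [if_neg hvx]
    have ht : (star a b x (T.bary x) (T.bary z)).support ∈ starFaces T a b x :=
      h.support_star_mem (T.bary_nonneg z) (T.mass_bary z) (T.support_bary_mem z)
    exact (bary_vertex ht.2.2 (mem_of_mem_starFaces hv hvx)).symm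

end Star

end Triangulation

namespace Triangulation

variable {P : Type*} [MetricSpace P]

/-! ### Cutting along the zero sets of affine functions -/

lemma pair_eq_of_card_eq_two {V : Type*} [DecidableEq V] {a b : V} {e : Finset V} (hab : a ≠ b)
    (ha : a ∈ e) (hb : b ∈ e) (he : e.card = 2) : {a, b} = e :=
  Finset.eq_of_subset_of_card_le (Finset.insert_subset ha (Finset.singleton_subset_iff.2 hb))
    (by rw [he, Finset.card_pair hab])

/-- The edges of `T` with end points in `A`, on which `φ` changes sign. -/
def crossedEdges (T : Triangulation P) (A : Set P) (φ : P → ℝ) : Set (Finset P) :=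
  {e ∈ T.faces | ∃ a ∈ A, ∃ b ∈ A, a ∈ e ∧ b ∈ e ∧ e.card = 2 ∧ φ a < 0 ∧ 0 < φ b}

/-- If no edge is crossed by the zero set of `φ`, then `φ` does not change sign on a simplex. -/
lemma sameSign_of_crossedEdges_eq_empty {T T' : Triangulation P} (h : T'.Refines T) {s : Finset P}
    {φ c : P → ℝ} (hφ : ∀ z ∈ T.simplex s, φ z = Finsupp.linearCombination ℝ c (T.bary z))
    (he : T'.crossedEdges (T.simplex s) φ = ∅) {t : Finset P} (ht : t ∈ T'.faces) {y z : P}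
    (hy : y ∈ T'.simplex t) (hz : z ∈ T'.simplex t) (hys : y ∈ T.simplex s)
    (hzs : z ∈ T.simplex s) : SameSign (φ y) (φ z) := by
  classical
  have hsum : ∀ y ∈ T.simplex s, φ y = ∑ v ∈ (T'.bary y).support, T'.bary y v * φ v := by
    intro y hy
    rw [h.linearCombination_eq hφ hy, linearCombination_eq_sum _ subset_rfl]
    rfl
  by_cases hpos : ∀ v ∈ t, v ∈ T.simplex s → 0 ≤ φ v
  · left
    have : ∀ y ∈ T'.simplex t, y ∈ T.simplex s → 0 ≤ φ y := fun y hy hys => by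
      rw [hsum y hys]
      exact Finset.sum_nonneg fun v hv => mul_nonneg (T'.bary_nonneg _ _)
        (hpos v (hy hv) (h.vertex_mem_simplex hys hv))
    exact ⟨this y hy hys, this z hz hzs⟩
  · right
    push Not at hpos
    obtain ⟨a, hat, has, ha⟩ := hpos
    have : ∀ y ∈ T'.simplex t, y ∈ T.simplex s → φ y ≤ 0 := fun y hy hys => by
      rw [hsum y hys]
      refine Finset.sum_nonpos fun v hv => mul_nonpos_of_nonneg_of_nonpos (T'.bary_nonneg _ _) ?_
      by_contra hv0
      have hab : a ≠ v := by rintro rfl; linarith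
      have : ({a, v} : Finset P) ∈ T'.crossedEdges (T.simplex s) φ :=
        ⟨mem_faces_of_subset ht (by
            intro u hu
            rcases Finset.mem_insert.1 hu with rfl | hu
            · exact hat
            · exact Finset.mem_singleton.1 hu ▸ hy hv) ⟨a, by simp⟩,
          a, has, v, h.vertex_mem_simplex hys hv, by simp, by simp, Finset.card_pair hab, ha,
          not_le.1 hv0⟩
      rw [he] at this
      exact this
    exact ⟨this y hy hys, this z hz hzs⟩

/-- Subdividing a crossed edge at the zero of `φ` on it decreases the number of crossed edges, since
all new edges end at the new vertex, where `φ` vanishes. -/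
lemma exists_refines_crossedEdges_ssubset {T T' : Triangulation P} (h : T'.Refines T)
    {s : Finset P} {φ c : P → ℝ}
    (hφ : ∀ z ∈ T.simplex s, φ z = Finsupp.linearCombination ℝ c (T.bary z))
    (hne : (T'.crossedEdges (T.simplex s) φ).Nonempty) :
    ∃ T'' : Triangulation P, T''.Refines T' ∧
      T''.crossedEdges (T.simplex s) φ ⊂ T'.crossedEdges (T.simplex s) φ := by
  classical
  obtain ⟨e, he⟩ := hne
  obtain ⟨hef, a, has, b, hbs, hae, hbe, hcard, ha, hb⟩ := id he
  have hab : a ≠ b := by rintro rfl; linarith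
  have hd : 0 < φ b - φ a := by linarith
  have hsup : (Finsupp.single a (φ b / (φ b - φ a)) +
      Finsupp.single b (-φ a / (φ b - φ a))).support = e := by
    have h1 : e = {a, b} := (pair_eq_of_card_eq_two hab hae hbe hcard).symm
    have h2 : φ b / (φ b - φ a) ≠ 0 := (div_pos hb hd).ne'
    have h3 : -φ a / (φ b - φ a) ≠ 0 := (div_pos (by linarith) hd).ne'
    rw [h1, Finsupp.support_add_eq, Finsupp.support_single _ h2,
      Finsupp.support_single _ h3]
    · rfl
    · rw [Finsupp.support_single _ h2, Finsupp.support_single _ h3]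
      simpa using hab
  obtain ⟨x, hx⟩ := T'.exists_bary_eq (w := Finsupp.single a (φ b / (φ b - φ a)) +
      Finsupp.single b (-φ a / (φ b - φ a))) (fun v => by
      have h2 := (div_pos hb hd).le
      have h3 : 0 ≤ -φ a / (φ b - φ a) := (div_pos (by linarith) hd).le
      rw [Finsupp.add_apply, Finsupp.single_apply, Finsupp.single_apply]
      split_ifs <;> positivity) (by
      rw [map_add, mass_single, mass_single]; field_simp; ring) (by rwa [hsup])
  have hxe : ∀ v, v ∈ (T'.bary x).support ↔ v = a ∨ v = b := by
    intro v
    rw [hx, hsup]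
    have h1 : ({a, b} : Finset P) = e := pair_eq_of_card_eq_two hab hae hbe hcard
    rw [← h1]; simp
  have hxs : x ∈ T.simplex s := h.mem_simplex_of_forall fun u hu => by
    rcases (hxe u).1 hu with rfl | rfl
    · exact has
    · exact hbs
  have hφx : φ x = 0 := by
    rw [h.linearCombination_eq hφ hxs, hx, map_add, Finsupp.linearCombination_single,
      Finsupp.linearCombination_single, smul_eq_mul, smul_eq_mul]
    field_simp
    ring
  have hE : T'.IsEdgePoint a b x := ⟨hab, hxe⟩
  refine ⟨T'.subdivide hE, subdivide_refines hE, ?_⟩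
  rw [Set.ssubset_iff_of_subset]
  · refine ⟨e, he, fun he' => ?_⟩
    have : e ∈ starFaces T' a b x := he'.1
    exact this.2.1.elim (fun h => h hae) (fun h => h hbe)
  · rintro e' ⟨he', a', ha's, b', hb's, hae', hbe', hcard', ha', hb'⟩
    refine ⟨?_, a', ha's, b', hb's, hae', hbe', hcard', ha', hb'⟩
    have hab' : a' ≠ b' := by rintro rfl; linarith
    have h1 : ({a', b'} : Finset P) = e' := pair_eq_of_card_eq_two hab' hae' hbe' hcard'
    have hxe' : x ∉ e' := by
      rw [← h1]
      simp only [Finset.mem_insert, Finset.mem_singleton]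
      rintro (rfl | rfl) <;> linarith
    have h2 : e' ∈ starFaces T' a b x := he'
    have := h2.2.2
    rwa [if_neg hxe'] at this

lemma exists_refines_sameSign {T T' : Triangulation P} (h : T'.Refines T) {s : Finset P}
    {φ c : P → ℝ} (hφ : ∀ z ∈ T.simplex s, φ z = Finsupp.linearCombination ℝ c (T.bary z)) :
    ∃ T'' : Triangulation P, T''.Refines T' ∧ ∀ t ∈ T''.faces, ∀ y ∈ T''.simplex t,
      ∀ z ∈ T''.simplex t, y ∈ T.simplex s → z ∈ T.simplex s → SameSign (φ y) (φ z) := by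
  have hfin : ∀ T' : Triangulation P, (T'.crossedEdges (T.simplex s) φ).Finite := fun T' =>
    T'.finite_faces.subset (sep_subset _ _)
  induction hn : (T'.crossedEdges (T.simplex s) φ).ncard using Nat.strong_induction_on
    generalizing T' with
  | _ n ih =>
    rcases (T'.crossedEdges (T.simplex s) φ).eq_empty_or_nonempty with he | hne
    · exact ⟨T', Refines.refl T', fun t ht y hy z hz hys hzs =>
        sameSign_of_crossedEdges_eq_empty h hφ he ht hy hz hys hzs⟩
    · obtain ⟨T₁, h1, h2⟩ := exists_refines_crossedEdges_ssubset h hφ hne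
      obtain ⟨T₂, h3, h4⟩ := ih _ (hn ▸ Set.ncard_lt_ncard h2 (hfin T')) (h1.trans h) rfl
      exact ⟨T₂, h3.trans h1, h4⟩

/-- Finitely many functions, each affine on one simplex of `T`, have no sign change on the simplices
of a suitable refinement of `T`. -/
lemma exists_refines_forall_sameSign (T : Triangulation P) {ι : Type*} (F : Finset ι)
    (s : ι → Finset P) (φ c : ι → P → ℝ) (hφ : ∀ i ∈ F, ∀ z ∈ T.simplex (s i),
      φ i z = Finsupp.linearCombination ℝ (c i) (T.bary z)) :
    ∃ T' : Triangulation P, T'.Refines T ∧ ∀ i ∈ F, ∀ t ∈ T'.faces, ∀ y ∈ T'.simplex t,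
      ∀ z ∈ T'.simplex t, y ∈ T.simplex (s i) → z ∈ T.simplex (s i) →
        SameSign (φ i y) (φ i z) := by
  classical
  induction F using Finset.induction_on with
  | empty => exact ⟨T, Refines.refl T, by simp⟩
  | insert i F _ ih =>
    obtain ⟨T₁, h1, h2⟩ := ih fun j hj => hφ j (Finset.mem_insert_of_mem hj)
    obtain ⟨T₂, h3, h4⟩ := exists_refines_sameSign h1 (hφ i (Finset.mem_insert_self _ _))
    refine ⟨T₂, h3.trans h1, fun j hj t ht y hy z hz hys hzs => ?_⟩
    rcases Finset.mem_insert.1 hj with rfl | hj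
    · exact h4 t ht y hy z hz hys hzs
    · obtain ⟨t', ht', hsub⟩ := h3.exists_simplex_subset ht
      exact h2 j hj t' ht' y (hsub hy) z (hsub hz) hys hzs

/-- The map of a simplex given by affine extension of the positions `p` of the vertices. -/
noncomputable def chart {E : Type*} [AddCommGroup E] [Module ℝ E] (T : Triangulation P) (p : P → E)
    (z : P) : E := Finsupp.linearCombination ℝ p (T.bary z)

/-- A map which on every simplex is, in an isometric chart, a piecewise isometric map of the
Euclidean space, is piecewise distance preserving. -/
theorem isPiecewiseDistancePreserving {n : ℕ} (T : Triangulation P)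
    (p : Finset P → P → EuclideanSpace ℝ (Fin n))
    (hp : ∀ s ∈ T.faces, ∀ y ∈ T.simplex s, ∀ z ∈ T.simplex s,
      dist y z = dist (T.chart (p s) y) (T.chart (p s) z))
    (f : P → EuclideanSpace ℝ (Fin n)) (F : Finset P → EuclideanSpace ℝ (Fin n) →
      EuclideanSpace ℝ (Fin n)) (hF : ∀ s ∈ T.faces, IsPiecewiseIsometric (F s))
    (hf : ∀ s ∈ T.faces, ∀ z ∈ T.simplex s, f z = F s (T.chart (p s) z)) :
    IsPiecewiseDistancePreserving f := by
  classical
  choose r hr using fun s : Finset P => show ∃ r : ℝ, ∀ z ∈ T.simplex s, ‖T.chart (p s) z‖ ≤ r by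
    refine ⟨∑ v ∈ s, ‖p s v‖, fun z hz => ?_⟩
    rw [chart, linearCombination_eq_sum _ (mem_simplex.1 hz)]
    refine (norm_sum_le _ _).trans (Finset.sum_le_sum fun v _ => ?_)
    rw [norm_smul, Real.norm_of_nonneg (T.bary_nonneg z v)]
    refine mul_le_of_le_one_left (norm_nonneg _) ?_
    by_cases hv : v ∈ s
    · rw [← sum_bary hz]
      exact Finset.single_le_sum (f := fun v => T.bary z v) (fun v _ => T.bary_nonneg z v) hv
    · rw [show T.bary z v = 0 from Finsupp.notMem_support_iff.1 fun h => hv (hz h)]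
      exact zero_le_one
  have hsel : ∀ s : Finset P, ∃ S : Set (EuclideanSpace ℝ (Fin n) → EuclideanSpace ℝ (Fin n)),
      S.Finite ∧ (∀ I ∈ S, Isometry I) ∧
      (s ∈ T.faces → ∀ x, ‖x‖ ≤ r s → ∃ I ∈ S, F s x = I x) := fun s => by
    by_cases hs : s ∈ T.faces
    · obtain ⟨S, h1, h2, h3⟩ := (hF s hs).2 (r s)
      exact ⟨S, h1, h2, fun _ => h3⟩
    · exact ⟨∅, finite_empty, by simp, fun h => absurd h hs⟩
  choose S hSfin hSiso hS using hsel
  set ι := Finset P × (EuclideanSpace ℝ (Fin n) → EuclideanSpace ℝ (Fin n)) ×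
    (EuclideanSpace ℝ (Fin n) → EuclideanSpace ℝ (Fin n)) × Fin n
  set G : Set ι := ⋃ s ∈ T.faces, {s} ×ˢ S s ×ˢ S s ×ˢ univ
  have hG : G.Finite := T.finite_faces.biUnion fun s _ =>
    (finite_singleton s).prod ((hSfin s).prod ((hSfin s).prod finite_univ))
  have hGmem : ∀ i : ι, i ∈ G ↔ i.1 ∈ T.faces ∧ i.2.1 ∈ S i.1 ∧ i.2.2.1 ∈ S i.1 := by
    rintro ⟨s, I, J, j⟩
    simp only [G, mem_iUnion, exists_prop]
    constructor
    · rintro ⟨s', h1, rfl, h2⟩; exact ⟨h1, h2.1, h2.2.1⟩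
    · rintro ⟨h1, h2⟩; exact ⟨s, h1, rfl, h2.1, h2.2, trivial⟩
  obtain ⟨T', hT', hsign⟩ := T.exists_refines_forall_sameSign hG.toFinset (fun i => i.1)
    (fun i z => (i.2.1 (T.chart (p i.1) z) - i.2.2.1 (T.chart (p i.1) z)) i.2.2.2)
    (fun i v => (i.2.1 (p i.1 v) - i.2.2.1 (p i.1 v)) i.2.2.2) (by
      rintro ⟨s, I, J, j⟩ hi z hz
      obtain ⟨hs, hI, hJ⟩ := (hGmem _).1 (hG.mem_toFinset.1 hi)
      simp only at hs hI hJ hz ⊢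
      have haff : ∀ I ∈ S s, I (T.chart (p s) z) = ∑ v ∈ s, T.bary z v • I (p s v) := by
        intro I hI
        have h1 := s.map_affineCombination (p s) (T.bary z) (sum_bary hz)
          (hSiso s I hI).affineIsometryOfStrictConvexSpace.toAffineMap
        rw [s.affineCombination_eq_linear_combination _ _ (sum_bary hz),
          s.affineCombination_eq_linear_combination _ _ (sum_bary hz)] at h1
        rw [chart, linearCombination_eq_sum _ (mem_simplex.1 hz)]
        exact h1
      rw [haff I hI, haff J hJ, linearCombination_eq_sum _ (mem_simplex.1 hz),
        ← Finset.sum_sub_distrib]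
      simp [mul_sub])
  refine ⟨T', fun t ht y hy z hz => ?_⟩
  obtain ⟨s, hs, hsub⟩ := hT'.exists_simplex_subset ht
  have hy' := hsub hy
  have hz' := hsub hz
  rw [hf s hs y hy', hf s hs z hz', hp s hs y hy' z hz']
  refine dist_eq_of_sameSign (S := S s) ?_ (hSfin s) (hSiso s) (fun c hc => hS s hs _ ?_)
    (fun I hI J hJ j => ?_)
  · exact ((hF s hs).1.continuous.comp AffineMap.lineMap_continuous).continuousOn
  · have := (convex_closedBall (0 : EuclideanSpace ℝ (Fin n)) (r s)).lineMap_mem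
      (mem_closedBall_zero_iff.2 (hr s y hy')) (mem_closedBall_zero_iff.2 (hr s z hz')) hc
    exact mem_closedBall_zero_iff.1 this
  · exact hsign (s, I, J, j) (hG.mem_toFinset.2 ((hGmem _).2 ⟨hs, hI, hJ⟩)) t ht y hy z hz hy' hz'

end Triangulation

/-! ### Euclidean charts and edges -/

lemma exists_linearIsometry {W : Type*} [NormedAddCommGroup W] [InnerProductSpace ℝ W]
    [FiniteDimensional ℝ W] {n : ℕ} (h : finrank ℝ W ≤ n) :
    Nonempty (W →ₗᵢ[ℝ] EuclideanSpace ℝ (Fin n)) := by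
  set b := stdOrthonormalBasis ℝ W
  set e : Fin (finrank ℝ W) → EuclideanSpace ℝ (Fin n) :=
    EuclideanSpace.basisFun (Fin n) ℝ ∘ Fin.castLE h
  have he : Orthonormal ℝ e :=
    (EuclideanSpace.basisFun (Fin n) ℝ).orthonormal.comp _ (Fin.castLE_injective h)
  refine ⟨(b.toBasis.constr ℝ e).isometryOfOrthonormal (v := b.toBasis) (by simp) ?_⟩
  convert he using 1
  ext1 i
  simp

namespace Triangulation

variable {P : Type*} [MetricSpace P]

lemma exists_mem_simplex_bary_eq {T : Triangulation P} {s : Finset P} (hs : s ∈ T.faces)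
    {w : P →₀ ℝ} (h0 : ∀ v, 0 ≤ w v) (h1 : mass P w = 1) (h2 : w.support ⊆ s) :
    ∃ x ∈ T.simplex s, T.bary x = w := by
  obtain ⟨x, hx⟩ := T.exists_bary_eq h0 h1 (mem_faces_of_subset hs h2 (by
    rw [Finsupp.support_nonempty_iff]
    rintro rfl
    rw [map_zero] at h1
    exact zero_ne_one h1))
  exact ⟨x, by rwa [mem_simplex, hx], hx⟩

/-- A simplex of dimension at most `n` has an isometric chart in `ℝⁿ`. -/
lemma exists_chart {T : Triangulation P} {s : Finset P} (hs : s ∈ T.faces) {n : ℕ}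
    (hn : s.card ≤ n + 1) : ∃ p : P → EuclideanSpace ℝ (Fin n), ∀ y ∈ T.simplex s,
      ∀ z ∈ T.simplex s, dist y z = dist (T.chart p y) (T.chart p z) := by
  classical
  obtain ⟨N, q, -, hq⟩ := exists_isometric_linearCombination hs
  obtain ⟨v₀, hv₀⟩ := nonempty_of_mem hs
  set W : Submodule ℝ (EuclideanSpace ℝ (Fin N)) :=
    Submodule.span ℝ ((s.erase v₀).image fun v => q v - q v₀)
  have hfin : finrank ℝ W ≤ n := by
    refine (finrank_span_finset_le_card _).trans (Finset.card_image_le.trans ?_)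
    rw [Finset.card_erase_of_mem hv₀]
    omega
  obtain ⟨Φ⟩ := exists_linearIsometry hfin
  obtain ⟨L, hL⟩ := Φ.toLinearMap.exists_extend
  have hLW : ∀ w ∈ W, ‖L w‖ = ‖w‖ := fun w hw => by
    have : L w = Φ ⟨w, hw⟩ := DFunLike.congr_fun hL ⟨w, hw⟩
    rw [this, Φ.norm_map]
    rfl
  refine ⟨L ∘ q, fun y hy z hz => ?_⟩
  have hchart : ∀ y, T.chart (L ∘ q) y = L (Finsupp.linearCombination ℝ q (T.bary y)) := fun y => by
    simp [chart, Finsupp.linearCombination_apply, Finsupp.sum]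
  rw [hq y hy z hz, hchart, hchart, dist_eq_norm, dist_eq_norm, ← map_sub L, hLW]
  rw [linearCombination_eq_sum q (mem_simplex.1 hy), linearCombination_eq_sum q (mem_simplex.1 hz)]
  have e : ∑ v ∈ s, T.bary y v • q v - ∑ v ∈ s, T.bary z v • q v =
      ∑ v ∈ s, (T.bary y v - T.bary z v) • (q v - q v₀) := by
    simp only [smul_sub, sub_smul, Finset.sum_sub_distrib, ← Finset.sum_smul]
    rw [sum_bary hy, sum_bary hz]
    abel
  rw [e]
  refine Submodule.sum_mem _ fun v hv => Submodule.smul_mem _ _ ?_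
  by_cases hvv : v = v₀
  · rw [hvv, sub_self]; exact Submodule.zero_mem _
  · exact Submodule.subset_span (Finset.mem_coe.2
      (Finset.mem_image_of_mem _ (Finset.mem_erase.2 ⟨hvv, hv⟩)))

lemma isCompact_simplex (T : Triangulation P) {s : Finset P} (hs : s ∈ T.faces) :
    IsCompact (T.simplex s) := by
  classical
  obtain ⟨N, q, -, hq⟩ := exists_isometric_linearCombination hs
  have key : ∀ u : stdSimplex ℝ s, ∃ x ∈ T.simplex s, T.bary x =
      Finsupp.mapDomain Subtype.val (Finsupp.indicator Finset.univ fun v _ => u.1 v) := fun u => by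
    refine exists_mem_simplex_bary_eq hs (fun v => ?_) ?_ fun v hv => ?_
    · by_cases hv : v ∈ s
      · have := Finsupp.mapDomain_apply Subtype.val_injective
          (Finsupp.indicator Finset.univ fun v _ => u.1 v) (⟨v, hv⟩ : s)
        rw [this, Finsupp.indicator_of_mem (Finset.mem_univ _)]
        exact u.2.1 _
      · rw [Finsupp.mapDomain_of_notMem_range _ _ fun ⟨i, hi⟩ => hv (hi ▸ i.2)]
    · rw [mass, linearCombination_mapDomain_indicator]
      simpa using u.2.2
    · by_contra hvs
      exact Finsupp.mem_support_iff.1 hv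
        (Finsupp.mapDomain_of_notMem_range _ _ fun ⟨i, hi⟩ => hvs (hi ▸ i.2))
  choose Ψ hΨs hΨ using key
  have hcont : Continuous Ψ := by
    have hA : Continuous fun u : stdSimplex ℝ s => ∑ v : s, u.1 v • q v :=
      continuous_finsetSum _ fun v _ =>
        ((continuous_apply v).comp continuous_subtype_val).smul continuous_const
    rw [Metric.continuous_iff] at hA ⊢
    intro u ε hε
    obtain ⟨δ, hδ, h⟩ := hA u ε hε
    refine ⟨δ, hδ, fun u' hu' => ?_⟩
    rw [hq _ (hΨs _) _ (hΨs _), hΨ, hΨ, linearCombination_mapDomain_indicator,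
      linearCombination_mapDomain_indicator]
    exact h u' hu'
  convert isCompact_range hcont
  refine Subset.antisymm (fun x hx => ?_) (range_subset_iff.2 hΨs)
  refine ⟨⟨fun v => T.bary x v, fun v => T.bary_nonneg x v, ?_⟩, T.bary_injective ?_⟩
  · rw [Finset.sum_coe_sort s fun v => T.bary x v, sum_bary hx]
  · rw [hΨ]
    ext v
    by_cases hv : v ∈ s
    · have := Finsupp.mapDomain_apply Subtype.val_injective
          (Finsupp.indicator Finset.univ fun (v : s) _ => T.bary x v) (⟨v, hv⟩ : s)
      rw [this, Finsupp.indicator_of_mem (Finset.mem_univ _)]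
    · rw [Finsupp.mapDomain_of_notMem_range _ _ fun ⟨i, hi⟩ => hv (hi ▸ i.2)]
      exact (Finsupp.notMem_support_iff.1 fun h => hv (hx h)).symm

lemma isCompact_univ (T : Triangulation P) : IsCompact (univ : Set P) := by
  have : (univ : Set P) = ⋃ s ∈ T.faces, T.simplex s :=
    (eq_univ_of_forall fun x => mem_biUnion (T.support_bary_mem x) (mem_simplex.2 subset_rfl)).symm
  rw [this]
  exact T.finite_faces.isCompact_biUnion fun s hs => T.isCompact_simplex hs

/-- The parametrization of an edge `{u, v}` by the distance to `u`. -/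
lemma exists_edge_param [DecidableEq P] {T : Triangulation P} {u v : P} (huv : u ≠ v)
    (he : {u, v} ∈ T.faces) : ∃ γ : ℝ → P,
      (∀ t ∈ Icc 0 (dist u v), γ t ∈ T.simplex {u, v}) ∧
      (∀ s ∈ Icc 0 (dist u v), ∀ t ∈ Icc 0 (dist u v), dist (γ s) (γ t) = |s - t|) ∧
      (∀ t ∈ Icc 0 (dist u v), dist (γ t) u = t) ∧
      (∀ x ∈ T.simplex {u, v}, dist x u ≤ dist u v ∧ γ (dist x u) = x) ∧
      ∀ {E : Type} [NormedAddCommGroup E] [NormedSpace ℝ E] (p : P → E),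
        ∀ t ∈ Icc 0 (dist u v), T.chart p (γ t) = AffineMap.lineMap (p u) (p v) (t / dist u v) := by
  obtain ⟨N, q, -, hq⟩ := exists_isometric_linearCombination he
  set L := dist u v
  have hL : 0 < L := dist_pos.2 huv
  have key : ∀ t ∈ Icc 0 L, ∃ x ∈ T.simplex {u, v},
      T.bary x = Finsupp.single u (1 - t / L) + Finsupp.single v (t / L) := fun t ht => by
    have h1 : 0 ≤ t / L := div_nonneg ht.1 hL.le
    have h2 : 0 ≤ 1 - t / L := sub_nonneg.2 ((div_le_one hL).2 ht.2)
    refine exists_mem_simplex_bary_eq he (fun w => ?_) ?_ ?_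
    · rw [Finsupp.add_apply, Finsupp.single_apply, Finsupp.single_apply]
      split_ifs <;> linarith
    · rw [map_add, mass_single, mass_single]; ring
    · refine Finsupp.support_add.trans (Finset.union_subset ?_ ?_) <;>
        refine Finsupp.support_single_subset.trans ?_ <;> simp
  have : Nonempty P := ⟨u⟩
  choose! γ hγ hγb using key
  have hchart : ∀ {E : Type} [NormedAddCommGroup E] [NormedSpace ℝ E] (p : P → E),
      ∀ t ∈ Icc 0 L, Finsupp.linearCombination ℝ p (T.bary (γ t)) =
        AffineMap.lineMap (p u) (p v) (t / L) := by
    intro E _ _ p t ht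
    rw [hγb t ht, map_add, Finsupp.linearCombination_single, Finsupp.linearCombination_single,
      AffineMap.lineMap_apply_module]
  have hvert : ∀ w ∈ ({u, v} : Finset P), Finsupp.linearCombination ℝ q (T.bary w) = q w :=
    fun w hw => by rw [bary_vertex he hw, Finsupp.linearCombination_single, one_smul]
  have hu : u ∈ ({u, v} : Finset P) := by simp
  have hv : v ∈ ({u, v} : Finset P) := by simp
  have hquv : dist (q u) (q v) = L := by
    rw [← hvert u hu, ← hvert v hv, ← hq u (vertex_mem_simplex he hu) v (vertex_mem_simplex he hv)]
  have hdist : ∀ s ∈ Icc 0 L, ∀ t ∈ Icc 0 L, dist (γ s) (γ t) = |s - t| := fun s hs t ht => by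
    rw [hq _ (hγ s hs) _ (hγ t ht), hchart q s hs, hchart q t ht, dist_lineMap_lineMap, hquv,
      Real.dist_eq, ← sub_div, abs_div, abs_of_pos hL, div_mul_cancel₀ _ hL.ne']
  have h0 : (0 : ℝ) ∈ Icc 0 L := ⟨le_rfl, hL.le⟩
  have hγ0 : γ 0 = u := T.bary_injective (by rw [hγb 0 h0, bary_vertex he hu]; simp)
  have hdu : ∀ t ∈ Icc 0 L, dist (γ t) u = t := fun t ht => by
    conv_lhs => rw [← hγ0]
    rw [hdist t ht 0 h0, sub_zero, abs_of_nonneg ht.1]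
  refine ⟨γ, hγ, hdist, hdu, fun x hx => ?_, fun p t ht => hchart p t ht⟩
  have hsum : T.bary x u + T.bary x v = 1 := by
    rw [← sum_bary hx, Finset.sum_pair huv]
  have ht : T.bary x v * L ∈ Icc 0 L := ⟨mul_nonneg (T.bary_nonneg _ _) hL.le,
    mul_le_of_le_one_left hL.le (by linarith [T.bary_nonneg x u])⟩
  have hx' : γ (T.bary x v * L) = x := T.bary_injective (by
    rw [hγb _ ht, mul_div_cancel_right₀ _ hL.ne']
    ext w
    rw [Finsupp.add_apply]
    by_cases h1 : w = u
    · subst h1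
      rw [Finsupp.single_eq_same, Finsupp.single_eq_of_ne huv]
      linarith
    by_cases h2 : w = v
    · subst h2
      rw [Finsupp.single_eq_same, Finsupp.single_eq_of_ne h1, zero_add]
    rw [Finsupp.single_eq_of_ne h1, Finsupp.single_eq_of_ne h2, add_zero]
    refine (Finsupp.notMem_support_iff.1 fun h => ?_).symm
    have := hx h
    simp [h1, h2] at this)
  have hd := hdu _ ht
  rw [hx'] at hd
  rw [hd]
  exact ⟨ht.2, hx'⟩

end Triangulation

/-! ### The map near a vertex and on an edge -/

/-- `f` does not increase the distances between points of `A`. -/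
def ShortOn {X Y : Type*} [Dist X] [Dist Y] (f : X → Y) (A : Set X) : Prop :=
  ∀ x ∈ A, ∀ y ∈ A, dist (f x) (f y) ≤ dist x y

namespace Triangulation

variable {P : Type*} [MetricSpace P]

/-- The values of `f` at the finitely many points of `A` determine `f` on the simplex `s`, among the
maps that are non-expanding there. -/
def Determines {E : Type*} [Dist E] (T : Triangulation P) (s : Finset P) (A : Set P) (f : P → E) :
    Prop :=
  A.Finite ∧ A ⊆ T.simplex s ∧
    ∀ k : P → E, ShortOn k (T.simplex s) → EqOn k f A → EqOn k f (T.simplex s)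

/-- The model near the vertex `w`: a zigzag of amplitude `τ` on a ray in the direction of `e`, which
depends only on the distance to `w`. -/
noncomputable def vertexModel {E : Type*} [AddCommGroup E] [Module ℝ E] (g : P → E) (τ : ℝ) (e : E)
    (w x : P) : E := g w + zigzag τ (dist x w) • e

lemma vertexModel_self {E : Type*} [AddCommGroup E] [Module ℝ E] (g : P → E) (τ : ℝ) (e : E)
    (w : P) : vertexModel g τ e w w = g w := by
  simp [vertexModel, zigzag_zero]

section

variable {E : Type*} [NormedAddCommGroup E] [NormedSpace ℝ E] {g : P → E} {τ : ℝ} {e : E} {w : P}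

lemma dist_vertexModel_le (hτ : 0 < τ) (he : ‖e‖ = 1) (x y : P) :
    dist (vertexModel g τ e w x) (vertexModel g τ e w y) ≤ dist x y := by
  rw [vertexModel, vertexModel, dist_add_left, dist_eq_norm, ← sub_smul, norm_smul, he, mul_one,
    Real.norm_eq_abs]
  refine (abs_zigzag_sub_le hτ _ _).trans ?_
  exact abs_dist_sub_le x y w

lemma dist_vertexModel_vertex_le (hτ : 0 < τ) (he : ‖e‖ = 1) (x : P) :
    dist (vertexModel g τ e w x) (g w) ≤ τ := by
  rw [vertexModel, dist_eq_norm, add_sub_cancel_left, norm_smul, he, mul_one,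
    Real.norm_of_nonneg (zigzag_nonneg _ _)]
  exact zigzag_le hτ _

end

variable {T : Triangulation P}

/-- On the part of an edge within distance `r` of its end point `u`, the model at `u` is determined
by finitely many of its values. -/
lemma exists_determining_vertexModel [DecidableEq P] {n : ℕ} {u v : P} (huv : u ≠ v)
    (huvT : {u, v} ∈ T.faces) {r : ℝ} (hr : 0 < r) (hru : r ≤ dist u v)
    (g : P → EuclideanSpace ℝ (Fin n)) {τ : ℝ} (hτ : 0 < τ) {e : EuclideanSpace ℝ (Fin n)}
    (he : ‖e‖ = 1) : ∃ A : Set P, A.Finite ∧ (∀ x ∈ A, x ∈ T.simplex {u, v} ∧ dist x u ≤ r) ∧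
      ∀ k : P → EuclideanSpace ℝ (Fin n), ShortOn k (T.simplex {u, v}) →
        EqOn k (vertexModel g τ e u) A →
        ∀ x ∈ T.simplex {u, v}, dist x u ≤ r → k x = vertexModel g τ e u x := by
  obtain ⟨γ, h1, h2, h3, h4, -⟩ := exists_edge_param huv huvT
  have hsub : Icc 0 r ⊆ Icc 0 (dist u v) := Icc_subset_Icc_right hru
  obtain ⟨M, hM, hzM⟩ := exists_finite_zigzag_eq hτ r
  have hfin : (M ×ˢ ({1, -1} : Set ℝ)).Finite := hM.prod (Set.toFinite _)
  obtain ⟨A, hA, hAsub, hdet⟩ := exists_finite_determining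
    (ψ := fun t => g u + zigzag τ t • e) hr.le (fun s _ t _ => by
      rw [dist_add_left, dist_eq_norm, ← sub_smul, norm_smul, he, mul_one, Real.norm_eq_abs]
      exact abs_zigzag_sub_le hτ s t)
    (hfin.image fun q : ℝ × ℝ => fun t : ℝ => g u + (q.2 * (t - q.1)) • e)
    (by
      rintro _ ⟨⟨m, σ⟩, ⟨-, hσ⟩, rfl⟩
      refine Isometry.of_dist_eq fun s t => ?_
      have hσ1 : |σ| = 1 := by
        have hσ' : σ = 1 ∨ σ = -1 := by simpa using hσ
        rcases hσ' with h | h <;> simp [h]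
      rw [dist_add_left, dist_eq_norm, ← sub_smul, norm_smul, he, mul_one, ← mul_sub,
        norm_mul, Real.norm_eq_abs σ, hσ1, one_mul, sub_sub_sub_cancel_right, Real.dist_eq,
        Real.norm_eq_abs])
    (fun t ht => by
      obtain ⟨m, hm, σ, hσ, hz⟩ := hzM t (by rw [abs_of_nonneg ht.1]; exact ht.2)
      exact ⟨_, ⟨(m, σ), ⟨hm, by simpa using hσ⟩, rfl⟩, by simp only [hz]⟩)
  refine ⟨γ '' A, hA.image _, ?_, fun k hk hkA x hx hxr => ?_⟩
  · rintro _ ⟨t, ht, rfl⟩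
    exact ⟨h1 t (hsub (hAsub ht)), (h3 t (hsub (hAsub ht))).trans_le (hAsub ht).2⟩
  · have hmodel : ∀ t ∈ Icc 0 r, vertexModel g τ e u (γ t) = g u + zigzag τ t • e := fun t ht => by
      rw [vertexModel, h3 t (hsub ht)]
    have := hdet (k ∘ γ) (fun s hs t ht => by
        rw [← h2 s (hsub hs) t (hsub ht)]
        exact hk _ (h1 s (hsub hs)) _ (h1 t (hsub ht)))
      (fun t ht => by rw [Function.comp_apply, hkA (mem_image_of_mem γ ht), hmodel t (hAsub ht)])
      (show dist x u ∈ Icc 0 r from ⟨dist_nonneg, hxr⟩)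
    rw [Function.comp_apply, (h4 x hx).2] at this
    exact this

/-- A piecewise isometric map of an edge is determined by finitely many of its values. -/
lemma exists_determines_of_isPiecewiseIsometric [DecidableEq P] {n : ℕ} {u v : P} (huv : u ≠ v)
    (huvT : {u, v} ∈ T.faces) {p : P → EuclideanSpace ℝ (Fin n)}
    (hp : ∀ y ∈ T.simplex {u, v}, ∀ z ∈ T.simplex {u, v},
      dist y z = dist (T.chart p y) (T.chart p z))
    {F : EuclideanSpace ℝ (Fin n) → EuclideanSpace ℝ (Fin n)} (hF : IsPiecewiseIsometric F) :
    ∃ A, T.Determines {u, v} A fun x => F (T.chart p x) := by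
  obtain ⟨γ, h1, h2, h3, h4, h5⟩ := exists_edge_param huv huvT
  set L := dist u v
  have hL : 0 < L := dist_pos.2 huv
  have h0 : (0 : ℝ) ∈ Icc 0 L := ⟨le_rfl, hL.le⟩
  have hLL : L ∈ Icc 0 L := ⟨hL.le, le_rfl⟩
  have hpuv : dist (p u) (p v) = L := by
    have := h5 p 0 h0
    rw [zero_div, AffineMap.lineMap_apply_zero] at this
    rw [← this]
    have := h5 p L hLL
    rw [div_self hL.ne', AffineMap.lineMap_apply_one] at this
    rw [← this, ← hp _ (h1 0 h0) _ (h1 L hLL), h2 0 h0 L hLL, zero_sub, abs_neg, abs_of_pos hL]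
  set G : ℝ → EuclideanSpace ℝ (Fin n) := fun t => AffineMap.lineMap (p u) (p v) (t / L) with hG
  have hGiso : Isometry G := Isometry.of_dist_eq fun s t => by
    rw [hG]
    simp only
    rw [dist_lineMap_lineMap, hpuv, Real.dist_eq, ← sub_div, abs_div, abs_of_pos hL,
      div_mul_cancel₀ _ hL.ne', Real.dist_eq]
  have hFL : ∀ x y, dist (F x) (F y) ≤ dist x y := fun x y => by simpa using hF.1.dist_le_mul x y
  obtain ⟨S, hS, hI, hFS⟩ := hF.2 (‖p u‖ + L)
  obtain ⟨A, hA, hAsub, hdet⟩ := exists_finite_determining (ψ := F ∘ G) hL.le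
    (fun s _ t _ => by
      refine (hFL _ _).trans_eq ?_
      rw [hGiso.dist_eq, Real.dist_eq])
    (hS.image fun I => I ∘ G) (by rintro _ ⟨I, h, rfl⟩; exact (hI I h).comp hGiso)
    (fun t ht => by
      obtain ⟨I, h, e⟩ := hFS (G t) (by
        have e1 : ‖G t‖ ≤ ‖G 0‖ + dist (G t) (G 0) := by
          rw [dist_eq_norm]; exact norm_le_insert' _ _
        have e2 : G 0 = p u := by simp [hG]
        rw [hGiso.dist_eq, Real.dist_eq, sub_zero, abs_of_nonneg ht.1, e2] at e1
        linarith [ht.2])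
      exact ⟨_, ⟨I, h, rfl⟩, e⟩)
  refine ⟨γ '' A, hA.image _, ?_, fun k hk hkA x hx => ?_⟩
  · rintro _ ⟨t, ht, rfl⟩
    exact h1 t (hAsub ht)
  · have := hdet (k ∘ γ) (fun s hs t ht => by
        rw [← h2 s hs t ht]
        exact hk _ (h1 s hs) _ (h1 t ht))
      (fun t ht => by
        rw [Function.comp_apply, hkA (mem_image_of_mem γ ht)]
        exact congrArg F (h5 p t (hAsub ht)))
      (show dist x u ∈ Icc 0 L from ⟨dist_nonneg, (h4 x hx).1⟩)
    have e := h5 p (dist x u) ⟨dist_nonneg, (h4 x hx).1⟩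
    rw [(h4 x hx).2] at e
    rw [Function.comp_apply, (h4 x hx).2, Function.comp_apply] at this
    simp only
    rw [this, e]

/-- Brehm's theorem in an isometric chart of a simplex. -/
lemma exists_isPiecewiseIsometric_chart {n : ℕ} [NeZero n] {s : Finset P}
    {p : P → EuclideanSpace ℝ (Fin n)}
    (hp : ∀ y ∈ T.simplex s, ∀ z ∈ T.simplex s, dist y z = dist (T.chart p y) (T.chart p z))
    {A : Set P} (hA : A.Finite) (hAs : A ⊆ T.simplex s) {φ : P → EuclideanSpace ℝ (Fin n)}
    (hφ : ShortOn φ A) :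
    ∃ F : EuclideanSpace ℝ (Fin n) → EuclideanSpace ℝ (Fin n), IsPiecewiseIsometric F ∧
      ShortOn (fun x => F (T.chart p x)) (T.simplex s) ∧ EqOn (fun x => F (T.chart p x)) φ A := by
  obtain ⟨F, h1, h2⟩ := exists_isPiecewiseIsometric_extension hA.toFinset (T.chart p) φ
    (fun x hx y hy => by
      rw [hA.mem_toFinset] at hx hy
      rw [← hp x (hAs hx) y (hAs hy)]
      exact hφ x hx y hy)
  refine ⟨F, h1, fun x hx y hy => ?_, fun x hx => h2 x (hA.mem_toFinset.2 hx)⟩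
  rw [hp x hx y hy]
  simpa using h1.1.dist_le_mul (T.chart p x) (T.chart p y)

/-- A map `g` on an edge, contracting and constant near the end points, is approximated by a
piecewise isometric map that coincides near the end points with their models. -/
lemma exists_edge_map [DecidableEq P] {n : ℕ} [NeZero n] {u v : P} (huv : u ≠ v)
    (huvT : {u, v} ∈ T.faces) {p : P → EuclideanSpace ℝ (Fin n)}
    (hp : ∀ y ∈ T.simplex {u, v}, ∀ z ∈ T.simplex {u, v},
      dist y z = dist (T.chart p y) (T.chart p z))
    {g : P → EuclideanSpace ℝ (Fin n)} {l r η τ : ℝ} (hl1 : l < 1)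
    (hg : ∀ x y, dist (g x) (g y) ≤ l * dist x y) (hr : 0 < r) (hη : 0 < η) (hηr : η ≤ r)
    (hru : 4 * r ≤ dist u v) (hgu : ∀ x, dist x u ≤ r → g x = g u)
    (hgv : ∀ x, dist x v ≤ r → g x = g v) (hτ : 0 < τ) (hτη : 2 * τ ≤ (1 - l) * η)
    (hτη' : τ ≤ η) {e : EuclideanSpace ℝ (Fin n)} (he : ‖e‖ = 1) :
    ∃ F : EuclideanSpace ℝ (Fin n) → EuclideanSpace ℝ (Fin n), IsPiecewiseIsometric F ∧
      (∀ x ∈ T.simplex {u, v}, dist (F (T.chart p x)) (g x) ≤ 3 * η) ∧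
      ∀ w ∈ ({u, v} : Finset P), ∀ x ∈ T.simplex {u, v}, dist x w ≤ r →
        F (T.chart p x) = vertexModel g τ e w x := by
  have hpair : ({v, u} : Finset P) = {u, v} := Finset.pair_comm v u
  obtain ⟨Au, hAu, hAu', hdetu⟩ := exists_determining_vertexModel huv huvT hr (by linarith) g hτ he
  obtain ⟨Av, hAv, hAv', hdetv⟩ := exists_determining_vertexModel huv.symm (hpair ▸ huvT) hr
    (by rw [dist_comm]; linarith) g hτ he
  rw [hpair] at hAv' hdetv
  have hg' : ∀ x y, dist (g x) (g y) ≤ dist x y := fun x y =>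
    (hg x y).trans (mul_le_of_le_one_left dist_nonneg hl1.le)
  have htri : ∀ x, dist u v ≤ dist x u + dist x v := fun x => dist_triangle_left u v x
  -- the middle part of the edge
  set Mid : Set P := {x ∈ T.simplex {u, v} | r + η ≤ dist x u ∧ r + η ≤ dist x v}
  obtain ⟨N, hNM, hN, hNcov⟩ := Metric.finite_approx_of_totallyBounded
    ((T.isCompact_simplex huvT).totallyBounded.subset (sep_subset _ _ : Mid ⊆ _)) η hη
  set φ : P → EuclideanSpace ℝ (Fin n) := fun x => if dist x u ≤ r then vertexModel g τ e u x else
    if dist x v ≤ r then vertexModel g τ e v x else g x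
  have hφu : ∀ x, dist x u ≤ r → φ x = vertexModel g τ e u x := fun x hx => if_pos hx
  have hφv : ∀ x, dist x v ≤ r → φ x = vertexModel g τ e v x := fun x hx => by
    simp only [φ]
    rw [if_neg (by linarith [htri x]), if_pos hx]
  have hφg : ∀ x ∈ Mid, φ x = g x := fun x hx => by
    simp only [φ]
    rw [if_neg (by linarith [hx.2.1]), if_neg (by linarith [hx.2.2])]
  have hclose : ∀ x, dist (φ x) (g x) ≤ τ := fun x => by
    simp only [φ]
    split_ifs with h1 h2
    · rw [hgu x h1]; exact dist_vertexModel_vertex_le hτ he x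
    · rw [hgv x h2]; exact dist_vertexModel_vertex_le hτ he x
    · rw [dist_self]; exact hτ.le
  -- at distance `η` or more, the contraction of `g` compensates for the error `τ` at both points
  have hfar : ∀ x y, η ≤ dist x y → dist (φ x) (φ y) ≤ dist x y := fun x y hxy => by
    have h1 := dist_triangle4 (φ x) (g x) (g y) (φ y)
    have h2 := hclose x
    have h3 := hclose y
    rw [dist_comm] at h3
    have h4 := hg x y
    have h5 := mul_le_mul_of_nonneg_left hxy (sub_nonneg.2 hl1.le)
    linarith
  have hshort : ShortOn φ (Au ∪ Av ∪ N) := by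
    have hcls : ∀ x ∈ Au ∪ Av ∪ N, dist x u ≤ r ∨ dist x v ≤ r ∨ x ∈ Mid := by
      rintro x ((hx | hx) | hx)
      · exact Or.inl (hAu' x hx).2
      · exact Or.inr (Or.inl (hAv' x hx).2)
      · exact Or.inr (Or.inr (hNM hx))
    have t1 : ∀ x y w : P, dist y w ≤ dist x w + dist x y := fun x y w => by
      rw [add_comm, dist_comm x y]; exact dist_triangle y x w
    intro x hx y hy
    rcases hcls x hx with h | h | h <;> rcases hcls y hy with h' | h' | h'
    · rw [hφu x h, hφu y h']; exact dist_vertexModel_le hτ he x y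
    · exact hfar x y (by linarith [htri x, t1 y x v, dist_comm x y])
    · exact hfar x y (by linarith [t1 x y u, h'.2.1])
    · exact hfar x y (by linarith [htri x, t1 y x u, dist_comm x y])
    · rw [hφv x h, hφv y h']; exact dist_vertexModel_le hτ he x y
    · exact hfar x y (by linarith [t1 x y v, h'.2.2])
    · exact hfar x y (by linarith [t1 y x u, h.2.1, dist_comm x y])
    · exact hfar x y (by linarith [t1 y x v, h.2.2, dist_comm x y])
    · rw [hφg x h, hφg y h']; exact hg' x y
  obtain ⟨F, hF, hFs, hFA⟩ := exists_isPiecewiseIsometric_chart hp ((hAu.union hAv).union hN)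
    (union_subset (union_subset (fun x hx => (hAu' x hx).1) fun x hx => (hAv' x hx).1)
      fun x hx => (hNM hx).1) hshort
  have hFu : ∀ x ∈ T.simplex {u, v}, dist x u ≤ r → F (T.chart p x) = vertexModel g τ e u x :=
    hdetu _ hFs fun x hx => (hFA (Or.inl (Or.inl hx))).trans (hφu x (hAu' x hx).2)
  have hFv : ∀ x ∈ T.simplex {u, v}, dist x v ≤ r → F (T.chart p x) = vertexModel g τ e v x :=
    hdetv _ hFs fun x hx => (hFA (Or.inl (Or.inr hx))).trans (hφv x (hAv' x hx).2)
  refine ⟨F, hF, fun x hx => ?_, fun w hw x hx hxw => ?_⟩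
  · -- it suffices to find a point of the edge near `x` where the map is close to `g`
    have hnear : ∀ y ∈ T.simplex {u, v}, dist x y ≤ η → dist (F (T.chart p y)) (g y) ≤ η →
        dist (F (T.chart p x)) (g x) ≤ 3 * η := fun y hy h1 h2 => by
      have h3 := dist_triangle4 (F (T.chart p x)) (F (T.chart p y)) (g y) (g x)
      have h4 := hFs x hx y hy
      have h5 := hg' y x
      rw [dist_comm y x] at h5
      simp only at h4
      linarith
    have hend : ∀ w w' : P, w ≠ w' → ({w, w'} : Finset P) = {u, v} → 4 * r ≤ dist w w' →
        (∀ x ∈ T.simplex {u, v}, dist x w ≤ r → F (T.chart p x) = vertexModel g τ e w x) →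
        (∀ x, dist x w ≤ r → g x = g w) → dist x w ≤ r + η →
        dist (F (T.chart p x)) (g x) ≤ 3 * η := by
      intro w w' hww hset hrw hFw hgw hxw
      have hclosew : ∀ y ∈ T.simplex {u, v}, dist y w ≤ r → dist (F (T.chart p y)) (g y) ≤ η :=
        fun y hy hyw => by
          rw [hFw y hy hyw, hgw y hyw]
          exact (dist_vertexModel_vertex_le hτ he y).trans hτη'
      rcases le_or_gt (dist x w) r with h | h
      · exact hnear x hx (by simpa using hη.le) (hclosew x hx h)
      · obtain ⟨γ, h1, h2, h3, h4, -⟩ := exists_edge_param hww (hset ▸ huvT)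
        rw [hset] at h1 h4
        have hr' : r ∈ Icc 0 (dist w w') := ⟨hr.le, by linarith⟩
        refine hnear (γ r) (h1 r hr') ?_ (hclosew _ (h1 r hr') (h3 r hr').le)
        obtain ⟨h5, h6⟩ := h4 x hx
        rw [← h6, h2 _ ⟨dist_nonneg, h5⟩ r hr', abs_of_pos (by linarith)]
        linarith
    rcases le_or_gt (dist x u) (r + η) with h | h
    · exact hend u v huv rfl hru hFu hgu h
    rcases le_or_gt (dist x v) (r + η) with h' | h'
    · exact hend v u huv.symm hpair (by rwa [dist_comm]) hFv hgv h'
    · obtain ⟨y, hy, hxy⟩ := mem_iUnion₂.1 (hNcov ⟨hx, h.le, h'.le⟩)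
      refine hnear y (hNM hy).1 (Metric.mem_ball.1 hxy).le ?_
      have := hFA (Or.inr hy)
      simp only at this
      rw [this, hφg y (hNM hy), dist_self]
      exact hη.le
  · rcases Finset.mem_insert.1 hw with rfl | hw
    · exact hFu x hx hxw
    · obtain rfl := Finset.mem_singleton.1 hw
      exact hFv x hx hxw

end Triangulation

/-! ### The approximation theorem -/

lemma exists_pos_forall_le {ι : Type*} {S : Set ι} (hS : S.Finite) {c : ι → ℝ}
    (hc : ∀ i ∈ S, 0 < c i) : ∃ κ > 0, ∀ i ∈ S, κ ≤ c i := by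
  rcases S.eq_empty_or_nonempty with rfl | hne
  · exact ⟨1, one_pos, by simp⟩
  · obtain ⟨i, hi, h⟩ := exists_min_image S c hS hne
    exact ⟨c i, hc i hi, h⟩

lemma IsCompact.exists_pos_le_dist {X : Type*} [MetricSpace X] {K : Set (X × X)} (hK : IsCompact K)
    (h : ∀ q ∈ K, q.1 ≠ q.2) : ∃ κ > 0, ∀ q ∈ K, κ ≤ dist q.1 q.2 := by
  rcases K.eq_empty_or_nonempty with rfl | hne
  · exact ⟨1, one_pos, by simp⟩
  · obtain ⟨q, hq, hmin⟩ := hK.exists_isMinOn hne (f := fun q : X × X => dist q.1 q.2)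
      (continuous_fst.dist continuous_snd).continuousOn
    exact ⟨_, dist_pos.2 (h q hq), fun q' hq' => hmin hq'⟩

namespace Triangulation

variable {P : Type*} [MetricSpace P] {T : Triangulation P}

lemma eq_of_support_subset_singleton {w x : P} (hw : {w} ∈ T.faces)
    (h : (T.bary x).support ⊆ {w}) : x = w := by
  refine T.bary_injective ?_
  have h1 := sum_bary (s := {w}) (mem_simplex.2 h)
  rw [Finset.sum_singleton] at h1
  rw [bary_vertex hw (Finset.mem_singleton_self w)]
  refine (Finsupp.eq_single_iff.2 ⟨h, h1⟩)

/-- Two simplices with at most one common vertex are uniformly separated away from it. -/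
lemma exists_separation (T : Triangulation P) {r : ℝ} (hr : 0 < r) : ∃ κ > 0,
    ∀ s ∈ T.faces, ∀ t ∈ T.faces, (∀ v ∈ s, ∀ w ∈ s, v ∈ t → w ∈ t → v = w) →
      ∀ x ∈ T.simplex s, ∀ y ∈ T.simplex t, (∀ w ∈ s, w ∈ t → r ≤ dist x w ∨ r ≤ dist y w) →
        κ ≤ dist x y := by
  have key : ∀ q : Finset P × Finset P, ∃ κ > 0, q ∈ T.faces ×ˢ T.faces →
      (∀ v ∈ q.1, ∀ w ∈ q.1, v ∈ q.2 → w ∈ q.2 → v = w) →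
      ∀ x ∈ T.simplex q.1, ∀ y ∈ T.simplex q.2,
        (∀ w ∈ q.1, w ∈ q.2 → r ≤ dist x w ∨ r ≤ dist y w) → κ ≤ dist x y := by
    rintro ⟨s, t⟩
    by_cases hst : (s ∈ T.faces ∧ t ∈ T.faces) ∧ ∀ v ∈ s, ∀ w ∈ s, v ∈ t → w ∈ t → v = w
    · obtain ⟨⟨hs, ht⟩, hone⟩ := hst
      set K : Set (P × P) := (T.simplex s ×ˢ T.simplex t) ∩
        ⋂ w : {w // w ∈ s ∧ w ∈ t}, {q | r ≤ dist q.1 w.1} ∪ {q | r ≤ dist q.2 w.1}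
      have hK : IsCompact K := by
        refine ((T.isCompact_simplex hs).prod (T.isCompact_simplex ht)).inter_right
          (isClosed_iInter fun w => IsClosed.union ?_ ?_)
        · exact isClosed_le continuous_const (continuous_fst.dist continuous_const)
        · exact isClosed_le continuous_const (continuous_snd.dist continuous_const)
      obtain ⟨κ, hκ, h⟩ := IsCompact.exists_pos_le_dist hK (by
        rintro ⟨x, y⟩ ⟨⟨hx, hy⟩, hfar⟩ (rfl : x = y)
        obtain ⟨w, hw⟩ := nonempty_of_mem (T.support_bary_mem x)
        have hwx : x = w := eq_of_support_subset_singleton (singleton_mem hs (hx hw)) fun v hv =>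
          Finset.mem_singleton.2 (hone v (hx hv) w (hx hw) (hy hv) (hy hw))
        have := mem_iInter.1 hfar ⟨w, hx hw, hy hw⟩
        simp only [hwx, mem_union, mem_ofPred_eq, dist_self, or_self] at this
        linarith)
      exact ⟨κ, hκ, fun _ _ x hx y hy hfar => h (x, y) ⟨⟨hx, hy⟩, mem_iInter.2 fun w =>
        hfar w.1 w.2.1 w.2.2⟩⟩
    · exact ⟨1, one_pos, fun h1 h2 => absurd ⟨h1, h2⟩ hst⟩
  choose κ' hκ' h using key
  obtain ⟨κ, hκ, hle⟩ := exists_pos_forall_le (T.finite_faces.prod T.finite_faces)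
    (fun q _ => hκ' q)
  exact ⟨κ, hκ, fun s hs t ht hone x hx y hy hfar =>
    (hle (s, t) ⟨hs, ht⟩).trans (h (s, t) ⟨hs, ht⟩ hone x hx y hy hfar)⟩

/-- Finitely many points in the interiors of the simplices, `ε`-dense in each interior, and their
positive distance to the proper faces. -/
lemma exists_interior_net (T : Triangulation P) {ε : ℝ} (hε : 0 < ε) :
    ∃ N : Finset P → Set P, (∀ s, (N s).Finite ∧ ∀ x ∈ N s, (T.bary x).support = s) ∧
      (∀ x, ∃ y ∈ N (T.bary x).support, dist x y < ε) ∧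
      ∃ κ > 0, ∀ s ∈ T.faces, ∀ t ∈ T.faces, ¬ s ⊆ t → ∀ x ∈ N s, ∀ y ∈ T.simplex t,
        κ ≤ dist x y := by
  have key : ∀ s : Finset P, ∃ N : Set P, (N.Finite ∧ ∀ x ∈ N, (T.bary x).support = s) ∧
      ∀ x, (T.bary x).support = s → ∃ y ∈ N, dist x y < ε := fun s => by
    obtain ⟨N, h1, h2, h3⟩ := Metric.finite_approx_of_totallyBounded
      (T.isCompact_univ.totallyBounded.subset (subset_univ {x | (T.bary x).support = s})) ε hε
    exact ⟨N, ⟨h2, h1⟩, fun x hx => by simpa using h3 hx⟩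
  choose N hN hNε using key
  have key2 : ∀ q : Finset P × Finset P, ∃ κ > 0, q ∈ T.faces ×ˢ T.faces → ¬ q.1 ⊆ q.2 →
      ∀ x ∈ N q.1, ∀ y ∈ T.simplex q.2, κ ≤ dist x y := by
    rintro ⟨s, t⟩
    by_cases hst : (s ∈ T.faces ∧ t ∈ T.faces) ∧ ¬ s ⊆ t
    · obtain ⟨κ, hκ, h⟩ := IsCompact.exists_pos_le_dist
        ((hN s).1.isCompact.prod (T.isCompact_simplex hst.1.2)) (by
          rintro ⟨x, y⟩ ⟨hx, hy⟩ (rfl : x = y)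
          exact hst.2 ((hN s).2 x hx ▸ hy))
      exact ⟨κ, hκ, fun _ _ x hx y hy => h (x, y) ⟨hx, hy⟩⟩
    · exact ⟨1, one_pos, fun h1 h2 => absurd ⟨h1, h2⟩ hst⟩
  choose κ' hκ' h using key2
  obtain ⟨κ, hκ, hle⟩ := exists_pos_forall_le (T.finite_faces.prod T.finite_faces)
    (fun q _ => hκ' q)
  exact ⟨N, hN, fun x => hNε _ x rfl, κ, hκ, fun s hs t ht hst x hx y hy =>
    (hle (s, t) ⟨hs, ht⟩).trans (h (s, t) ⟨hs, ht⟩ hst x hx y hy)⟩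

/-- Non-expanding maps of the edges, compatible with the vertex models, extend together with
prescribed values at interior points to a piecewise isometric map of the simplex `s`. -/
lemma exists_face_map {n : ℕ} [NeZero n] {s : Finset P} (hs : s ∈ T.faces)
    {p : P → EuclideanSpace ℝ (Fin n)}
    (hp : ∀ y ∈ T.simplex s, ∀ z ∈ T.simplex s, dist y z = dist (T.chart p y) (T.chart p z))
    (hs2 : 2 < s.card) {g f : P → EuclideanSpace ℝ (Fin n)} {l r η τ κ : ℝ} (hl1 : l < 1)
    (hg : ∀ x y, dist (g x) (g y) ≤ l * dist x y) (hτ : 0 < τ) {e : EuclideanSpace ℝ (Fin n)}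
    (he : ‖e‖ = 1) {A : Finset P → Set P}
    (hA : ∀ t ∈ T.faces, t.card = 2 → T.Determines t (A t) f)
    (hfs : ∀ t ∈ T.faces, t.card = 2 → ShortOn f (T.simplex t))
    (hfg : ∀ t ∈ T.faces, t.card = 2 → ∀ x ∈ T.simplex t, dist (f x) (g x) ≤ η)
    (hfv : ∀ t ∈ T.faces, t.card = 2 → ∀ w ∈ t, ∀ x ∈ T.simplex t, dist x w ≤ r →
      f x = vertexModel g τ e w x)
    (hη : 2 * η ≤ (1 - l) * κ) (hη0 : 0 ≤ η)
    (hκ : ∀ t ∈ T.faces, ∀ t' ∈ T.faces, (∀ v ∈ t, ∀ w ∈ t, v ∈ t' → w ∈ t' → v = w) →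
      ∀ x ∈ T.simplex t, ∀ y ∈ T.simplex t', (∀ w ∈ t, w ∈ t' → r ≤ dist x w ∨ r ≤ dist y w) →
        κ ≤ dist x y)
    {N : Set P} (hN : N.Finite) (hNs : ∀ x ∈ N, (T.bary x).support = s)
    (hNκ : ∀ t ∈ T.faces, ¬ s ⊆ t → ∀ x ∈ N, ∀ y ∈ T.simplex t, κ ≤ dist x y) :
    ∃ F : EuclideanSpace ℝ (Fin n) → EuclideanSpace ℝ (Fin n), IsPiecewiseIsometric F ∧
      ShortOn (fun x => F (T.chart p x)) (T.simplex s) ∧ (∀ x ∈ N, F (T.chart p x) = g x) ∧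
      ∀ t ⊆ s, t.card = 2 → ∀ x ∈ T.simplex t, F (T.chart p x) = f x := by
  classical
  set φ : P → EuclideanSpace ℝ (Fin n) := fun x => if (T.bary x).support = s then g x else f x
  set 𝓔 : Set (Finset P) := {t | t ⊆ s ∧ t.card = 2}
  have h𝓔 : ∀ t ∈ 𝓔, t ∈ T.faces := fun t ht =>
    mem_faces_of_subset hs ht.1 (Finset.card_pos.1 (by rw [ht.2]; norm_num))
  have h𝓔s : ∀ t ∈ 𝓔, ¬ s ⊆ t := fun t ht h => by
    have := Finset.card_le_card h
    have := ht.2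
    omega
  have hφN : ∀ x ∈ N, φ x = g x := fun x hx => if_pos (hNs x hx)
  have hφE : ∀ t ∈ 𝓔, ∀ x ∈ T.simplex t, φ x = f x := fun t ht x hx => if_neg fun h =>
    h𝓔s t ht (by rw [← h]; exact mem_simplex.1 hx)
  have hfar : ∀ x y, dist (φ x) (g x) ≤ η → dist (φ y) (g y) ≤ η → κ ≤ dist x y →
      dist (φ x) (φ y) ≤ dist x y := fun x y h2 h3 hxy => by
    have h1 := dist_triangle4 (φ x) (g x) (g y) (φ y)
    rw [dist_comm] at h3
    have h4 := hg x y
    have h5 := mul_le_mul_of_nonneg_left hxy (sub_nonneg.2 hl1.le)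
    linarith
  have hcN : ∀ x ∈ N, dist (φ x) (g x) ≤ η := fun x hx => by rw [hφN x hx, dist_self]; exact hη0
  have hcE : ∀ t ∈ 𝓔, ∀ x ∈ T.simplex t, dist (φ x) (g x) ≤ η := fun t ht x hx => by
    rw [hφE t ht x hx]; exact hfg t (h𝓔 t ht) ht.2 x hx
  -- points of two different edges are at distance at least `κ`, or near a common vertex `w`, where
  -- the values depend on the distance to `w` only, through the same model
  have hEE : ∀ t ∈ 𝓔, ∀ x ∈ T.simplex t, ∀ t' ∈ 𝓔, ∀ y ∈ T.simplex t',
      dist (φ x) (φ y) ≤ dist x y := by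
    intro t ht x hx t' ht' y hy
    by_cases htt : t = t'
    · subst htt
      rw [hφE t ht x hx, hφE t ht y hy]
      exact hfs t (h𝓔 t ht) ht.2 x hx y hy
    by_cases hnear : ∀ w ∈ t, w ∈ t' → r ≤ dist x w ∨ r ≤ dist y w
    · refine hfar x y (hcE t ht x hx) (hcE t' ht' y hy)
        (hκ t (h𝓔 t ht) t' (h𝓔 t' ht') ?_ x hx y hy hnear)
      intro v hv w hw hv' hw'
      by_contra hvw
      exact htt ((pair_eq_of_card_eq_two hvw hv hw ht.2).symm.trans
        (pair_eq_of_card_eq_two hvw hv' hw' ht'.2))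
    · push Not at hnear
      obtain ⟨w, hw, hw', h1, h2⟩ := hnear
      rw [hφE t ht x hx, hφE t' ht' y hy, hfv t (h𝓔 t ht) ht.2 w hw x hx h1.le,
        hfv t' (h𝓔 t' ht') ht'.2 w hw' y hy h2.le]
      exact dist_vertexModel_le hτ he x y
  have h𝓔fin : 𝓔.Finite := T.finite_faces.subset h𝓔
  have hshort : ShortOn φ (N ∪ ⋃ t ∈ 𝓔, A t) := by
    rintro x (hx | hx) y (hy | hy)
    · rw [hφN x hx, hφN y hy]
      exact (hg x y).trans (mul_le_of_le_one_left dist_nonneg hl1.le)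
    · obtain ⟨t, ht, hy⟩ := mem_iUnion₂.1 hy
      have hy := (hA t (h𝓔 t ht) ht.2).2.1 hy
      exact hfar x y (hcN x hx) (hcE t ht y hy) (hNκ t (h𝓔 t ht) (h𝓔s t ht) x hx y hy)
    · obtain ⟨t, ht, hx⟩ := mem_iUnion₂.1 hx
      have hx := (hA t (h𝓔 t ht) ht.2).2.1 hx
      refine hfar x y (hcE t ht x hx) (hcN y hy) ?_
      rw [dist_comm]
      exact hNκ t (h𝓔 t ht) (h𝓔s t ht) y hy x hx
    · obtain ⟨t, ht, hx⟩ := mem_iUnion₂.1 hx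
      obtain ⟨t', ht', hy⟩ := mem_iUnion₂.1 hy
      exact hEE t ht x ((hA t (h𝓔 t ht) ht.2).2.1 hx) t' ht' y
        ((hA t' (h𝓔 t' ht') ht'.2).2.1 hy)
  have hsub : ∀ t ∈ 𝓔, T.simplex t ⊆ T.simplex s := fun t ht x hx => Subset.trans hx ht.1
  obtain ⟨F, hF, hFs, hFA⟩ := exists_isPiecewiseIsometric_chart hp
    (hN.union (h𝓔fin.biUnion fun t ht => (hA t (h𝓔 t ht) ht.2).1))
    (union_subset (fun x hx => mem_simplex.2 (hNs x hx).le)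
      (iUnion₂_subset fun t ht => (hA t (h𝓔 t ht) ht.2).2.1.trans (hsub t ht))) hshort
  refine ⟨F, hF, hFs, fun x hx => (hFA (Or.inl hx)).trans (hφN x hx), fun t hts ht2 => ?_⟩
  have ht : t ∈ 𝓔 := ⟨hts, ht2⟩
  refine (hA t (h𝓔 t ht) ht2).2.2 _ (fun x hx y hy => hFs x (hsub t ht hx) y (hsub t ht hy)) ?_
  intro x hx
  exact (hFA (Or.inr (mem_biUnion ht hx))).trans (hφE t ht x ((hA t (h𝓔 t ht) ht2).2.1 hx))

lemma Determines.congr {E : Type*} [Dist E] {s : Finset P} {A : Set P} {f f' : P → E}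
    (h : T.Determines s A f) (hff : EqOn f f' (T.simplex s)) : T.Determines s A f' :=
  ⟨h.1, h.2.1, fun k hk hkA => (h.2.2 k hk (hkA.trans (hff.mono h.2.1).symm)).trans hff⟩

lemma exists_pos_le_dist_edges [DecidableEq P] (T : Triangulation P) : ∃ κ > 0, ∀ u v : P, u ≠ v →
    {u, v} ∈ T.faces → κ ≤ dist u v := by
  have hfin : {q : P × P | q.1 ≠ q.2 ∧ {q.1, q.2} ∈ T.faces}.Finite := by
    refine (T.finite_faces.biUnion fun s _ => s.finite_toSet.prod s.finite_toSet).subset ?_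
    rintro ⟨u, v⟩ ⟨-, h⟩
    exact mem_biUnion h ⟨by simp, by simp⟩
  obtain ⟨κ, hκ, h⟩ := exists_pos_forall_le hfin (c := fun q => dist q.1 q.2)
    fun q hq => dist_pos.2 hq.1
  exact ⟨κ, hκ, fun u v huv hT => h (u, v) ⟨huv, hT⟩⟩

lemma eq_of_card_support_eq_one {s : Finset P} (hs : s ∈ T.faces) {x : P} (hx : x ∈ T.simplex s)
    (h : (T.bary x).support.card = 1) : x ∈ s ∧ (T.bary x).support = {x} := by
  obtain ⟨w, hw⟩ := Finset.card_eq_one.1 h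
  have hws : w ∈ s := hx (show w ∈ (T.bary x).support by rw [hw]; exact Finset.mem_singleton_self w)
  have hxw : x = w := eq_of_support_subset_singleton (singleton_mem hs hws) hw.le
  rw [hw, hxw]
  exact ⟨hws, rfl⟩

lemma card_support_pos (T : Triangulation P) (x : P) : 0 < (T.bary x).support.card :=
  Finset.card_pos.2 (nonempty_of_mem (T.support_bary_mem x))

/-- A contracting map that is constant near the vertices can be approximated: first on the edges,
then on the triangles. -/
theorem exists_approx_of_locallyConst (hT : ∀ s ∈ T.faces, s.card ≤ 3)
    {g : P → EuclideanSpace ℝ (Fin 2)} {l : ℝ} (hl1 : l < 1)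
    (hg : ∀ x y, dist (g x) (g y) ≤ l * dist x y) {r₀ : ℝ} (hr₀ : 0 < r₀)
    (hgr : ∀ v, {v} ∈ T.faces → ∀ x, dist x v ≤ r₀ → g x = g v) {ε : ℝ} (hε : 0 < ε) :
    ∃ f : P → EuclideanSpace ℝ (Fin 2),
      IsPiecewiseDistancePreserving f ∧ ∀ x, dist (f x) (g x) ≤ ε := by
  classical
  have hl : 0 < 1 - l := sub_pos.2 hl1
  have hg' : ∀ x y, dist (g x) (g y) ≤ dist x y := fun x y =>
    (hg x y).trans (mul_le_of_le_one_left dist_nonneg hl1.le)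
  choose! p hp using fun s (hs : s ∈ T.faces) => exists_chart hs (n := 2) (hT s hs)
  obtain ⟨κ₀, hκ₀, hedge⟩ := T.exists_pos_le_dist_edges
  set r := min r₀ (κ₀ / 4)
  have hr : 0 < r := lt_min hr₀ (by positivity)
  have hr4 : 4 * r ≤ κ₀ := by have : r ≤ κ₀ / 4 := min_le_right _ _; linarith
  obtain ⟨N, hN, hNε, κ₁, hκ₁, hNκ⟩ := T.exists_interior_net (half_pos hε)
  obtain ⟨κ₂, hκ₂, hsep⟩ := T.exists_separation hr
  set κ := min κ₁ κ₂
  have hκ : 0 < κ := lt_min hκ₁ hκ₂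
  -- the error on the edges has to be small compared with the distances `κ`, and the amplitude of
  -- the zigzags has to be small compared with that error
  set η := min r (min (ε / 4) ((1 - l) * κ / 6))
  have hη : 0 < η := lt_min hr (lt_min (by positivity) (by positivity))
  have hηε : η ≤ ε / 4 := (min_le_right _ _).trans (min_le_left _ _)
  have hηκ : η ≤ (1 - l) * κ / 6 := (min_le_right _ _).trans (min_le_right _ _)
  set τ := min η ((1 - l) * η / 2)
  have hτ : 0 < τ := lt_min hη (by positivity)
  have hτ2 : 2 * τ ≤ (1 - l) * η := by
    have : τ ≤ (1 - l) * η / 2 := min_le_right _ _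
    linarith
  set e : EuclideanSpace ℝ (Fin 2) := EuclideanSpace.single 0 1
  have he : ‖e‖ = 1 := by simp [e]
  have hgv : ∀ s ∈ T.faces, ∀ v ∈ s, ∀ x, dist x v ≤ r → g x = g v := fun s hs v hv x hx =>
    hgr v (singleton_mem hs hv) x (hx.trans (min_le_left _ _))
  -- the map on the edges
  have hFE : ∀ t ∈ T.faces, ∃ F : EuclideanSpace ℝ (Fin 2) → EuclideanSpace ℝ (Fin 2),
      t.card = 2 → IsPiecewiseIsometric F ∧
      (∀ x ∈ T.simplex t, dist (F (T.chart (p t) x)) (g x) ≤ 3 * η) ∧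
      ∀ w ∈ t, ∀ x ∈ T.simplex t, dist x w ≤ r →
        F (T.chart (p t) x) = vertexModel g τ e w x := fun t ht => by
    by_cases ht2 : t.card = 2
    · obtain ⟨u, v, huv, rfl⟩ := Finset.card_eq_two.1 ht2
      obtain ⟨F, hF⟩ := exists_edge_map huv ht (hp _ ht) hl1 hg hr hη (min_le_left _ _)
        (hr4.trans (hedge u v huv ht)) (hgv _ ht u (by simp)) (hgv _ ht v (by simp)) hτ hτ2
        (min_le_left _ _) he
      exact ⟨F, fun _ => hF⟩
    · exact ⟨id, fun h => absurd h ht2⟩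
  choose! FE hFE using hFE
  set f₁ : P → EuclideanSpace ℝ (Fin 2) := fun x => if (T.bary x).support.card = 2 then
    FE (T.bary x).support (T.chart (p (T.bary x).support) x) else g x
  have hf₁ : ∀ t ∈ T.faces, t.card = 2 → ∀ x ∈ T.simplex t, f₁ x = FE t (T.chart (p t) x) := by
    intro t ht ht2 x hx
    by_cases hx2 : (T.bary x).support.card = 2
    · have hxt : (T.bary x).support = t := Finset.eq_of_subset_of_card_le hx (by rw [hx2, ht2])
      simp only [f₁]
      rw [if_pos hx2, hxt]
    · have h1 : (T.bary x).support.card = 1 := by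
        have := Finset.card_le_card (mem_simplex.1 hx)
        have := T.card_support_pos x
        omega
      have hxt := (eq_of_card_support_eq_one ht hx h1).1
      rw [(hFE t ht ht2).2.2 x hxt x hx (by simpa using hr.le), vertexModel_self]
      exact if_neg hx2
  have hf₁g : ∀ x, dist (f₁ x) (g x) ≤ 3 * η := fun x => by
    by_cases hx2 : (T.bary x).support.card = 2
    · rw [hf₁ _ (T.support_bary_mem x) hx2 x (mem_simplex.2 subset_rfl)]
      exact (hFE _ (T.support_bary_mem x) hx2).2.1 x (mem_simplex.2 subset_rfl)
    · simp only [f₁]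
      rw [if_neg hx2, dist_self]
      positivity
  have hA : ∀ t ∈ T.faces, ∃ A, t.card = 2 → T.Determines t A f₁ := fun t ht => by
    by_cases ht2 : t.card = 2
    · obtain ⟨u, v, huv, rfl⟩ := Finset.card_eq_two.1 ht2
      obtain ⟨A, hA⟩ := exists_determines_of_isPiecewiseIsometric huv ht (hp _ ht)
        (hFE _ ht ht2).1
      exact ⟨A, fun _ => hA.congr fun x hx => (hf₁ _ ht ht2 x hx).symm⟩
    · exact ⟨∅, fun h => absurd h ht2⟩
  choose! A hA using hA
  -- the map on all simplices
  have hFS : ∀ s ∈ T.faces, ∃ F : EuclideanSpace ℝ (Fin 2) → EuclideanSpace ℝ (Fin 2),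
      IsPiecewiseIsometric F ∧
      (∀ x ∈ T.simplex s, (T.bary x).support.card ≤ 2 → F (T.chart (p s) x) = f₁ x) ∧
      (2 < s.card → ∀ x, (T.bary x).support = s → dist (F (T.chart (p s) x)) (g x) ≤ ε) := by
    intro s hs
    have hpos := Finset.card_pos.2 (nonempty_of_mem hs)
    rcases lt_trichotomy s.card 2 with hs2 | hs2 | hs2
    · -- a vertex is mapped to its image by a translation
      obtain ⟨w, hw⟩ := nonempty_of_mem hs
      refine ⟨fun y => y + (g w - T.chart (p s) w),
        isPiecewiseIsometric_of_isometry (isometry_add_right _), fun x hx _ => ?_,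
        fun h => by omega⟩
      have hx1 : (T.bary x).support.card = 1 := by
        have := Finset.card_le_card (mem_simplex.1 hx)
        have := T.card_support_pos x
        omega
      obtain rfl : x = w := Finset.card_le_one.1 (by omega)
        x (eq_of_card_support_eq_one hs hx hx1).1 w hw
      simp only [f₁]
      rw [if_neg (by omega)]
      abel
    · exact ⟨FE s, (hFE s hs hs2).1, fun x hx _ => (hf₁ s hs hs2 x hx).symm, fun h => by omega⟩
    · obtain ⟨F, h1, h2, h3, h4⟩ := exists_face_map (T := T) (f := f₁) (η := 3 * η) (κ := κ) hs
        (hp s hs) hs2 hl1 hg hτ he hA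
        (fun t ht ht2 x hx y hy => by
          rw [hf₁ t ht ht2 x hx, hf₁ t ht ht2 y hy, hp t ht x hx y hy]
          simpa using (hFE t ht ht2).1.1.dist_le_mul (T.chart (p t) x) (T.chart (p t) y))
        (fun t ht ht2 x hx => hf₁g x)
        (fun t ht ht2 w hw x hx hxw => by
          rw [hf₁ t ht ht2 x hx, (hFE t ht ht2).2.2 w hw x hx hxw])
        (by linarith) (by positivity)
        (fun t ht t' ht' hone x hx y hy hfar =>
          (min_le_right _ _).trans (hsep t ht t' ht' hone x hx y hy hfar))
        (hN s).1 (hN s).2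
        (fun t ht hst x hx y hy => (min_le_left _ _).trans (hNκ s hs t ht hst x hx y hy))
      refine ⟨F, h1, fun x hx hx2 => ?_, fun _ x hxs => ?_⟩
      · have hxpos := T.card_support_pos x
        rcases (show (T.bary x).support.card = 2 ∨ (T.bary x).support.card = 1 by omega) with h | h
        · exact h4 _ hx h x (mem_simplex.2 subset_rfl)
        · obtain ⟨hxs, hxe⟩ := eq_of_card_support_eq_one hs hx h
          obtain ⟨w, hw, hwx⟩ := Finset.exists_mem_ne (by omega : 1 < s.card) x
          refine h4 {x, w} ?_ (Finset.card_pair hwx.symm) x ?_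
          · exact Finset.insert_subset hxs (Finset.singleton_subset_iff.2 hw)
          · rw [mem_simplex, hxe]; simp
      · obtain ⟨y, hy, hxy⟩ := hNε x
        rw [hxs] at hy
        have h5 := h2 x (mem_simplex.2 hxs.le) y (mem_simplex.2 ((hN s).2 y hy).le)
        have h6 := dist_triangle (F (T.chart (p s) x)) (F (T.chart (p s) y)) (g x)
        rw [h3 y hy] at h6
        simp only at h5
        rw [h3 y hy] at h5
        have h7 := hg' y x
        rw [dist_comm y x] at h7
        linarith
  choose! F hF using hFS
  set f : P → EuclideanSpace ℝ (Fin 2) := fun x => if (T.bary x).support.card ≤ 2 then f₁ x else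
    F (T.bary x).support (T.chart (p (T.bary x).support) x)
  refine ⟨f, T.isPiecewiseDistancePreserving p hp f F (fun s hs => (hF s hs).1)
    fun s hs x hx => ?_, fun x => ?_⟩
  · by_cases hx2 : (T.bary x).support.card ≤ 2
    · rw [(hF s hs).2.1 x hx hx2]
      exact if_pos hx2
    · have hxs : (T.bary x).support = s := Finset.eq_of_subset_of_card_le hx (by
        have := hT s hs
        omega)
      simp only [f]
      rw [if_neg hx2, hxs]
  · by_cases hx2 : (T.bary x).support.card ≤ 2
    · simp only [f]
      rw [if_pos hx2]
      exact (hf₁g x).trans (by linarith)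
    · simp only [f]
      rw [if_neg hx2]
      exact (hF _ (T.support_bary_mem x)).2.2 (not_le.1 hx2) x rfl

/-- Every non-expanding map of a polyhedral space of dimension at most `2` to the plane can be
approximated by piecewise distance preserving maps. -/
theorem exists_approx (hT : ∀ s ∈ T.faces, s.card ≤ 3) {h : P → EuclideanSpace ℝ (Fin 2)}
    (hh : LipschitzWith 1 h) {ε : ℝ} (hε : 0 < ε) : ∃ f : P → EuclideanSpace ℝ (Fin 2),
      IsPiecewiseDistancePreserving f ∧ ∀ x, dist (f x) (h x) < ε := by
  classical
  obtain ⟨M, hM⟩ := T.isCompact_univ.exists_bound_of_continuousOn hh.continuous.continuousOn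
  -- `h` is made contracting by the factor `1 - m`, and then constant near the vertices
  set m := min (1 / 2) (ε / (4 * (|M| + 1)))
  have hm : 0 < m := lt_min (by norm_num) (by positivity)
  have hm1 : m ≤ 1 / 2 := min_le_left _ _
  have hmM : m * |M| ≤ ε / 4 := by
    have h1 : m * (4 * (|M| + 1)) ≤ ε := (le_div_iff₀ (by positivity)).1 (min_le_right _ _)
    linarith
  have hVfin : {v : P | {v} ∈ T.faces}.Finite :=
    T.finite_faces.preimage (Finset.singleton_injective.injOn)
  obtain ⟨r, hr, ψ, h1, h2, h3⟩ := exists_locallyConst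
    (hVfin.toFinset.image fun v => (1 - m) • h v) (show 0 < ε / 4 by positivity)
  have hlip : ∀ x y, dist ((1 - m) • h x) ((1 - m) • h y) ≤ (1 - m) * dist x y := fun x y => by
    rw [dist_smul₀, Real.norm_of_nonneg (by linarith)]
    exact mul_le_mul_of_nonneg_left (by simpa using hh.dist_le_mul x y) (by linarith)
  obtain ⟨f, hf, hfg⟩ := exists_approx_of_locallyConst (T := T) hT
    (g := fun x => ψ ((1 - m) • h x)) (l := 1 - m) (by linarith)
    (fun x y => (h1 _ _).trans (hlip x y)) hr
    (fun v hv x hx => h3 _ (Finset.mem_image_of_mem _ (hVfin.mem_toFinset.2 hv)) _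
      ((hlip x v).trans ((mul_le_of_le_one_left dist_nonneg (by linarith)).trans hx)))
    (show 0 < ε / 4 by positivity)
  refine ⟨f, hf, fun x => ?_⟩
  have h4 := hfg x
  have h5 := h2 ((1 - m) • h x)
  have h6 : dist ((1 - m) • h x) (h x) ≤ ε / 4 := by
    rw [dist_eq_norm, sub_smul, one_smul, sub_sub_cancel_left, norm_neg, norm_smul,
      Real.norm_of_nonneg hm.le]
    exact (mul_le_mul_of_nonneg_left ((hM x trivial).trans (le_abs_self M)) hm.le).trans hmM
  have h7 := dist_triangle4 (f x) (ψ ((1 - m) • h x)) ((1 - m) • h x) (h x)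
  linarith

end Triangulation

end Polyhedral

theorem mainTheorem2 {P : Type*} [MetricSpace P] (hP : Polyhedral.IsPolyhedralSpace P 2) :
    (∀ h : P → EuclideanSpace ℝ (Fin 2), LipschitzWith 1 h → Polyhedral.IsPiecewiseLinear h →
      ∀ ε : ℝ, 0 < ε → ∃ f : P → EuclideanSpace ℝ (Fin 2),
        Polyhedral.IsPiecewiseDistancePreserving f ∧ ∀ x : P, dist (f x) (h x) < ε) ∧
    (∃ f : P → EuclideanSpace ℝ (Fin 2), Polyhedral.IsPiecewiseDistancePreserving f) := by
  obtain ⟨-, T, hT, -⟩ := hP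
  refine ⟨fun h hh _ ε hε => Polyhedral.Triangulation.exists_approx hT hh hε, ?_⟩
  obtain ⟨f, hf, -⟩ := Polyhedral.Triangulation.exists_approx hT (LipschitzWith.const' 0) one_pos
  exact ⟨f, hf⟩
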